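/- Let $d\ge 3$, let $\Gamma=\mathbb Z^d$, and let $\Gamma^*=(\mathbb R/2\pi\mathbb Z)^d$ carry its normalized Haar measure $d\mu^*(p)=(2\pi)^{-d}\,d^dp$. Let $\mathfrak e\in C^2(\Gamma^*,\mathbb R)$ be an admissible dispersion relation, i.e. a Morse function (the Hessian of $\mathfrak e$ is nondegenerate at every critical point) whose range is $\mathfrak e(\Gamma^*)=[0,\mathfrak e_{\max}]$ for some $\mathfrak e_{\max}\in\mathbb R$. Let $\mathcal F:L^2(\Gamma^*,\mu^*)\to\ell^2(\Gamma)$, $(\mathcal F\psi)(x)=\int_{\Gamma^*}e^{i\langle p,x\rangle}\psi(p)\,d\mu^*(p)$, be the Fourier transform and $h(\mathfrak e)=\mathcal F\,\mathfrak e\,\mathcal F^*$ the corresponding Fourier multiplier on $\ell^2(\Gamma)$. For a bounded function $V:\Gamma\to[0,\infty)$, acting on $\ell^2(\Gamma)$ by multiplication, let $H(\mathfrak e,V)=h(\mathfrak e)-V$, let $$N[\mathfrak e,V]=\operatorname{Tr}\big\{\mathbf 1[H(\mathfrak e,V)<0]\big\}\in[0,\infty]$$ be the number of its negative eigenvalues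 counted with multiplicity (equal to $\infty$ if $H(\mathfrak e,V)$ has essential spectrum in $(-\infty,0)$), and let $$N_{sc}[\mathfrak e,V]=\sum_{x\in\Gamma}\int_{\Gamma^*}\mathbf 1[\mathfrak e(p)-V(x)<0]\,d\mu^*(p)\in[0,\infty].$$ Then there is a constant $C(d,\mathfrak e)\in[1,\infty)$, depending only on $d$ and $\mathfrak e$, such that $$N[\mathfrak e,V]\ \le\ C(d,\mathfrak e)\,N_{sc}[\mathfrak e,V]\ <\ \infty\qquad\text{for all } V\in\ell^{d/2}(\Gamma,[0,\infty)).$$ -/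

import Mathlib

open MeasureTheory
open scoped ENNReal NNReal CompactlySupported

noncomputable section

namespace LatticeSchrodinger

/-! ### Spectral measures and the trace of a spectral projection -/

section Spectral

variable {E : Type*} [NormedAddCommGroup E] [InnerProductSpace ℂ E] [CompleteSpace E]

/-- The positive linear functional `f ↦ ⟨φ, f(A) φ⟩` on `C_c(ℝ, ℝ)`, where `f(A)` is given by the
continuous functional calculus of the (self-adjoint) bounded operator `A`. -/
def spectralFunctional (A : E →L[ℂ] E) (φ : E) : C_c(ℝ, ℝ) →ₚ[ℝ] ℝ :=
  PositiveLinearMap.mk₀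
    { toFun := fun f => (inner ℂ φ (cfc (fun t : ℝ => f t) A φ)).re
      map_add' := fun f g => by
        have h : cfc (fun t : ℝ => (f + g) t) A
            = cfc (fun t : ℝ => f t) A + cfc (fun t : ℝ => g t) A :=
          cfc_add A (fun t : ℝ => f t) (fun t : ℝ => g t)
            f.continuous.continuousOn g.continuous.continuousOn
        rw [h, add_apply, inner_add_right, Complex.add_re]
      map_smul' := fun c f => by
        have h : cfc (fun t : ℝ => (c • f) t) A = c • cfc (fun t : ℝ => f t) A :=
          cfc_smul c (fun t : ℝ => f t) A f.continuous.continuousOn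
        rw [h, smul_apply, RCLike.real_smul_eq_coe_smul (K := ℂ),
          inner_smul_right]
        simp }
    (fun f hf => by
      have h0 : (0 : E →L[ℂ] E) ≤ cfc (fun t : ℝ => f t) A := cfc_nonneg fun t _ => hf t
      exact ((ContinuousLinearMap.nonneg_iff_isPositive _).1 h0).re_inner_nonneg_right φ)

/-- The spectral measure `μ_φ` of the self-adjoint operator `A` at the vector `φ`, i.e. the Borel
measure on `ℝ` with `∫ f dμ_φ = ⟨φ, f(A) φ⟩`. The spectral projection `1[A ∈ S]` of the Borel
functional calculus has the quadratic form `⟨φ, 1[A ∈ S] φ⟩ = μ_φ(S)`. -/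
def spectralMeasure (A : E →L[ℂ] E) (φ : E) : Measure ℝ :=
  RealRMK.rieszMeasure (spectralFunctional A φ)

/-- `Tr 1[A < 0]`, computed as `∑ᵢ ⟨bᵢ, 1[A < 0] bᵢ⟩` in the orthonormal basis `b`: the number
in `[0, ∞]` of negative eigenvalues of `A`, counting multiplicities (infinite if `A` has essential
spectrum below `0`). -/
def traceNegProj {ι : Type*} (b : HilbertBasis ι ℂ E) (A : E →L[ℂ] E) : ℝ≥0∞ :=
  ∑' i, spectralMeasure A (b i) (Set.Iio 0)

end Spectral

/-! ### The lattice `ℤ^d` and its dual torus -/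

/-- The Hilbert space `ℓ²(ℤ^d)`. -/
abbrev ell2 (d : ℕ) : Type := lp (fun _ : Fin d → ℤ => ℂ) 2

/-- The dual torus `Γ* = (ℝ/2πℤ)^d`. It is modelled on `(ℝ/ℤ)^d`, the momentum
`p ∈ (ℝ/2πℤ)^d` corresponding to `p/(2π)`. -/
abbrev DualTorus (d : ℕ) : Type := UnitAddTorus (Fin d)

/-- The normalized Haar measure `dμ*(p) = dp/(2π)^d` of the torus. -/
def haarTorus (d : ℕ) : Measure (DualTorus d) :=
  Measure.pi fun _ => AddCircle.haarAddCircle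

instance (d : ℕ) : IsProbabilityMeasure (haarTorus d) := by
  unfold haarTorus; infer_instance

instance (d : ℕ) : Measure.IsAddHaarMeasure (haarTorus d) := by
  unfold haarTorus; infer_instance

/-- The point of the torus with momentum `p ∈ ℝ^d`, i.e. the covering `ℝ^d → (ℝ/2πℤ)^d`. -/
def ofMomentum {d : ℕ} (p : Fin d → ℝ) : DualTorus d :=
  fun i => ((p i / (2 * Real.pi) : ℝ) : UnitAddCircle)

/-- A `C²` function on the torus is a Morse function if at all of its critical points the Hessian
is nondegenerate. All derivatives are taken in the momentum coordinates `p ∈ ℝ^d`. -/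
structure IsMorseC2 {d : ℕ} (e : DualTorus d → ℝ) : Prop where
  contDiff : ContDiff ℝ 2 (fun p : Fin d → ℝ => e (ofMomentum p))
  nondegenerate : ∀ p : Fin d → ℝ, fderiv ℝ (fun q => e (ofMomentum q)) p = 0 →
    ∀ u : Fin d → ℝ,
      (∀ w, fderiv ℝ (fderiv ℝ (fun q => e (ofMomentum q))) p u w = 0) → u = 0

/-- Admissible dispersion relations: Morse functions of class `C²` on the torus with range
`[0, e_max]`. -/
structure IsAdmissible {d : ℕ} (e : DualTorus d → ℝ) : Prop where
  morse : IsMorseC2 e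
  range_eq : ∃ emax : ℝ, Set.range e = Set.Icc 0 emax

/-- The Hilbert space `L²(Γ*, μ*)`. -/
abbrev L2Torus (d : ℕ) : Type := Lp ℂ 2 (haarTorus d)

/-- The function `p ↦ e^{-i⟨p,x⟩}` in `L²(Γ*, μ*)`, for `x ∈ ℤ^d`. -/
def expVec {d : ℕ} (x : Fin d → ℤ) : L2Torus d :=
  ContinuousMap.toLp (E := ℂ) 2 (haarTorus d) ℂ (UnitAddTorus.mFourier (-x))

theorem orthonormal_expVec (d : ℕ) : Orthonormal ℂ (expVec (d := d)) :=
  (UnitAddTorus.orthonormal_mFourier (d := Fin d)).comp _ neg_injective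

theorem span_expVec (d : ℕ) :
    ⊤ ≤ (Submodule.span ℂ (Set.range (expVec (d := d)))).topologicalClosure := by
  have h : Set.range (expVec (d := d)) = Set.range fun x : Fin d → ℤ =>
      ContinuousMap.toLp (E := ℂ) 2 (haarTorus d) ℂ (UnitAddTorus.mFourier x) :=
    (Equiv.neg (Fin d → ℤ)).surjective.range_comp fun x : Fin d → ℤ =>
      ContinuousMap.toLp (E := ℂ) 2 (haarTorus d) ℂ (UnitAddTorus.mFourier x)
  rw [h]
  exact (UnitAddTorus.span_mFourierLp_closure_eq_top (d := Fin d) (p := 2) (by simp)).ge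

/-- The Hilbert basis `p ↦ e^{-i⟨p,x⟩}`, `x ∈ ℤ^d`, of `L²(Γ*, μ*)`. -/
def expBasis (d : ℕ) : HilbertBasis (Fin d → ℤ) ℂ (L2Torus d) :=
  HilbertBasis.mk (orthonormal_expVec d) (span_expVec d)

/-- The Fourier transform `F : L²(Γ*) → ℓ²(ℤ^d)`, `(F ψ)(x) = ∫ e^{i⟨p,x⟩} ψ(p) dμ*(p)`; its
inverse is `F* : ℓ²(ℤ^d) → L²(Γ*)`, `(F* φ)(p) = ∑ₓ e^{-i⟨p,x⟩} φ(x)`. -/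
def fourierF (d : ℕ) : L2Torus d ≃ₗᵢ[ℂ] ell2 d :=
  (expBasis d).repr

/-- Multiplication by the continuous function `e` on `L²(Γ*)`. -/
def mulTorus {d : ℕ} (e : C(DualTorus d, ℝ)) :
    L2Torus d →L[ℂ] L2Torus d :=
  (ContinuousLinearMap.mul ℂ ℂ).holderL (haarTorus d) ∞ 2 2
    (ContinuousMap.toLp (E := ℂ) ∞ (haarTorus d) ℂ
      ⟨fun k => (e k : ℂ), Complex.continuous_ofReal.comp e.continuous⟩)

/-- The hopping matrix `h(e) = F e F*` on `ℓ²(ℤ^d)`. -/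
def hopping {d : ℕ} (e : C(DualTorus d, ℝ)) : ell2 d →L[ℂ] ell2 d :=
  ((fourierF d).toContinuousLinearEquiv : _ →L[ℂ] ell2 d) ∘L mulTorus e ∘L
    ((fourierF d).symm.toContinuousLinearEquiv : ell2 d →L[ℂ] _)

/-- Multiplication by the bounded function `V` on `ℓ²(ℤ^d)`. -/
def potential {d : ℕ} (V : (Fin d → ℤ) → ℝ≥0) (hV : Memℓp (fun x => (V x : ℝ)) ∞) :
    ell2 d →L[ℂ] ell2 d :=
  lp.mapCLM 2 (fun x => ((V x : ℝ) : ℂ) • ContinuousLinearMap.id ℂ ℂ)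
    (K := ⨆ x, ‖(V x : ℝ)‖) (Real.iSup_nonneg fun _ => norm_nonneg _)
    (fun x => by
      rw [norm_smul, ContinuousLinearMap.norm_id, mul_one, Complex.norm_real]
      exact le_ciSup (memℓp_infty_iff.1 hV) x)

/-- The lattice Schrödinger operator `H(e, V) = h(e) - V` on `ℓ²(ℤ^d)`. -/
def hamiltonian {d : ℕ} (e : C(DualTorus d, ℝ)) (V : (Fin d → ℤ) → ℝ≥0)
    (hV : Memℓp (fun x => (V x : ℝ)) ∞) : ell2 d →L[ℂ] ell2 d :=
  hopping e - potential V hV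

/-- `N[e, V] = Tr 1[H(e, V) < 0]`; the trace is computed in the canonical orthonormal basis
`(δ_x)_x` of `ℓ²(ℤ^d)`. -/
def numNegEigenvalues {d : ℕ} (e : C(DualTorus d, ℝ)) (V : (Fin d → ℤ) → ℝ≥0)
    (hV : Memℓp (fun x => (V x : ℝ)) ∞) : ℝ≥0∞ :=
  traceNegProj (HilbertBasis.ofRepr (LinearIsometryEquiv.refl ℂ (ell2 d))) (hamiltonian e V hV)

/-- The semi-classical number `N_sc[e, V] = ∑ₓ ∫ 1[e(p) - V(x) < 0] dμ*(p)`. -/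
def semiclassicalNumber {d : ℕ} (e : DualTorus d → ℝ) (V : (Fin d → ℤ) → ℝ≥0) : ℝ≥0∞ :=
  ∑' x, ∫⁻ k, Set.indicator {k : DualTorus d | e k - V x < 0} 1 k ∂(haarTorus d)

end LatticeSchrodinger

end

/-! Both sides are compared with the sum over sites of min(1, V(x)^{d/2}). A zero of `e` is a
minimum, so the Morse condition makes the Hessian there positive definite and `e` is locally
squeezed between two multiples of the squared distance. Hence {e < s²} has measure at most C s^d for
all s (`IsAdmissible.exists_sublevel_le`) and at least c s^d for small s
(`IsAdmissible.exists_le_sublevel`).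

By Glazman's lemma (`traceNegProj_le`) it suffices to bound the dimension of a subspace W on which
the form of H is negative. The finitely many sites with V > s₀² cost one dimension each, and each
contributes at least c s₀^d to the semiclassical number. On the remaining sites V^{d/2} is bounded
by a multiple of the semiclassical contribution, so a Cwikel–Lieb–Rozenblum bound finishes the
proof.

That bound follows the method of Rumin and Frank. Choose vectors of W orthonormal for the form of
h(e) and split them at energy t. Bessel's inequality bounds the low-energy density by the integral
of 1/e over {e < t}; integrating the high-energy part over t and summing over x returns the form
itself (`tsum_mul_density_le`). For d ≥ 3 the low-energy integral is O(t^{d/2-1}) by the sublevel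
estimate (`mul_lowEnergyInverse_le`). -/

noncomputable section

namespace LatticeSchrodinger

/-! ### Spectral projections and negative subspaces (Glazman's lemma). -/

section SpectralProjection

variable {E : Type*} [NormedAddCommGroup E] [InnerProductSpace ℂ E]

/-- An orthonormal family projected to a finite-dimensional subspace has total squared length at
most the dimension. -/
theorem sum_norm_sq_starProjection_le {ι : Type*} {b : ι → E} (hb : Orthonormal ℂ b)
    (W : Submodule ℂ E) [FiniteDimensional ℂ W] (S : Finset ι) :
    ∑ x ∈ S, ‖W.starProjection (b x)‖ ^ 2 ≤ Module.finrank ℂ W := by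
  set w := stdOrthonormalBasis ℂ W
  have key : ∀ x, ‖W.starProjection (b x)‖ ^ 2 = ∑ j, ‖inner ℂ (b x) (w j : E)‖ ^ 2 := by
    intro x
    rw [Submodule.starProjection_apply, ← Submodule.coe_norm, ← w.sum_sq_norm_inner_right]
    refine Finset.sum_congr rfl fun j _ => ?_
    rw [Submodule.coe_inner, ← Submodule.starProjection_apply,
      ← Submodule.inner_starProjection_left_eq_right,
      Submodule.starProjection_eq_self_iff.2 (w j).2, norm_inner_symm]
  simp_rw [key]
  rw [Finset.sum_comm]
  calc ∑ j, ∑ x ∈ S, ‖inner ℂ (b x) (w j : E)‖ ^ 2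
      ≤ ∑ j, (1 : ℝ) := by
        refine Finset.sum_le_sum fun j _ => (hb.sum_inner_products_le (w j : E)).trans ?_
        rw [← Submodule.coe_norm, w.norm_eq_one]; norm_num
    _ = Module.finrank ℂ W := by simp

variable [CompleteSpace E]

theorem re_inner_cfc_mono {A : E →L[ℂ] E} {f g : ℝ → ℝ} (hf : Continuous f) (hg : Continuous g)
    (h : ∀ t, f t ≤ g t) (φ : E) :
    (inner ℂ φ (cfc f A φ)).re ≤ (inner ℂ φ (cfc g A φ)).re := by
  have h1 : cfc f A ≤ cfc g A :=
    cfc_mono (fun t _ => h t) hf.continuousOn hg.continuousOn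
  rw [ContinuousLinearMap.le_def] at h1
  have := h1.re_inner_nonneg_right φ
  rw [sub_apply, inner_sub_right] at this
  simpa using this

theorem inner_cfc_left (A : E →L[ℂ] E) (f : ℝ → ℝ) (φ ψ : E) :
    inner ℂ (cfc f A φ) ψ = inner ℂ φ (cfc f A ψ) := by
  have h : IsSelfAdjoint (cfc f A) := cfc_predicate f A
  exact (ContinuousLinearMap.isSelfAdjoint_iff_isSymmetric.1 h) φ ψ

/-- If `0 ≤ f ≤ 1`, then `‖f(A) φ‖² ≤ ⟨φ, f(A) φ⟩`. -/
theorem norm_cfc_sq_le {A : E →L[ℂ] E} {f : ℝ → ℝ} (hf : Continuous f)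
    (h0 : ∀ t, 0 ≤ f t) (h1 : ∀ t, f t ≤ 1) (φ : E) :
    ‖cfc f A φ‖ ^ 2 ≤ (inner ℂ φ (cfc f A φ)).re := by
  have h := re_inner_cfc_mono (A := A) (f := fun t => f t * f t) (hf.mul hf) hf
    (fun t => mul_le_of_le_one_left (h0 t) (h1 t)) φ
  have h2 : cfc (fun t => f t * f t) A = cfc f A * cfc f A :=
    cfc_mul f f A hf.continuousOn hf.continuousOn
  rw [h2, mul_apply_eq_comp, ← inner_cfc_left] at h
  rwa [← inner_self_eq_norm_sq (𝕜 := ℂ)]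

/-- If `f` vanishes on `(-ε, ∞)`, the quadratic form of `A` is at most `-ε` on the range of
`f(A)`. -/
theorem re_inner_cfc_apply_le {A : E →L[ℂ] E} (hA : IsSelfAdjoint A) {f : ℝ → ℝ}
    (hf : Continuous f) {ε : ℝ} (hε : ∀ t, -ε < t → f t = 0) (φ : E) :
    (inner ℂ (cfc f A φ) (A (cfc f A φ))).re ≤ -ε * ‖cfc f A φ‖ ^ 2 := by
  have h := re_inner_cfc_mono (A := A) (f := fun t => f t * (t * f t))
    (g := fun t => -ε * (f t * f t)) (by fun_prop) (by fun_prop)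
    (fun t => by
      rcases lt_or_ge (-ε) t with ht | ht
      · simp [hε t ht]
      · nlinarith [mul_self_nonneg (f t)]) φ
  have h2 : cfc (fun t => f t * (t * f t)) A = cfc f A * (A * cfc f A) := by
    rw [cfc_mul f (fun t => t * f t) A hf.continuousOn (by fun_prop),
      cfc_mul (fun t => t) f A (by fun_prop) hf.continuousOn, cfc_id' ℝ A]
  have h3 : cfc (fun t => -ε * (f t * f t)) A = (-ε) • (cfc f A * cfc f A) := by
    rw [cfc_const_mul (-ε) (fun t => f t * f t) A (by fun_prop),
      cfc_mul f f A hf.continuousOn hf.continuousOn]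
  rw [h2, h3, smul_apply, mul_apply_eq_comp,
    mul_apply_eq_comp, mul_apply_eq_comp, ← inner_cfc_left,
    RCLike.real_smul_eq_coe_smul (K := ℂ), inner_smul_right, ← inner_cfc_left] at h
  rw [← inner_self_eq_norm_sq (𝕜 := ℂ)]
  simpa using h

/-- The vectors f(A)b_x with x in S span a finite-dimensional W in the range of f(A), where the form
of A is negative. With P the projection onto W, ⟨b, f(A)b⟩ = ⟨Pb, f(A)b⟩ ≤ ‖Pb‖ ‖f(A)b‖ and ‖f(A)b‖²
≤ ⟨b, f(A)b⟩ give ⟨b, f(A)b⟩ ≤ ‖Pb‖², and these squares sum to at most dim W. -/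
theorem sum_re_inner_cfc_le {A : E →L[ℂ] E} (hA : IsSelfAdjoint A) {M : ℝ≥0∞}
    (hM : ∀ W : Submodule ℂ E, FiniteDimensional ℂ W →
      (∀ ψ ∈ W, ψ ≠ 0 → (inner ℂ ψ (A ψ)).re < 0) → (Module.finrank ℂ W : ℝ≥0∞) ≤ M)
    {f : ℝ → ℝ} (hf : Continuous f) (h0 : ∀ t, 0 ≤ f t) (h1 : ∀ t, f t ≤ 1)
    {ε : ℝ} (hε0 : 0 < ε) (hε : ∀ t, -ε < t → f t = 0)
    {ι : Type*} {b : ι → E} (hb : Orthonormal ℂ b) (S : Finset ι) :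
    ∑ x ∈ S, ENNReal.ofReal (inner ℂ (b x) (cfc f A (b x))).re ≤ M := by
  classical
  set W : Submodule ℂ E := Submodule.span ℂ (S.image fun x => cfc f A (b x) : Finset E)
  have hWmem : ∀ x ∈ S, cfc f A (b x) ∈ W := fun x hx =>
    Submodule.subset_span (Finset.mem_coe.2 (Finset.mem_image_of_mem _ hx))
  have hWrange : W ≤ LinearMap.range (cfc f A : E →L[ℂ] E).toLinearMap := by
    refine Submodule.span_le.2 fun y hy => ?_
    obtain ⟨x, -, rfl⟩ := Finset.mem_image.1 (Finset.mem_coe.1 hy)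
    exact ⟨b x, rfl⟩
  have hdim := hM W inferInstance fun ψ hψ hne => by
    obtain ⟨φ, rfl⟩ := hWrange hψ
    refine (re_inner_cfc_apply_le hA hf hε φ).trans_lt ?_
    have : 0 < ‖cfc f A φ‖ := norm_pos_iff.2 hne
    nlinarith [mul_pos hε0 (pow_pos this 2)]
  have hnn : ∀ x, 0 ≤ (inner ℂ (b x) (cfc f A (b x))).re := fun x =>
    (sq_nonneg _).trans (norm_cfc_sq_le hf h0 h1 (b x))
  rw [← ENNReal.ofReal_sum_of_nonneg fun x _ => hnn x]
  refine le_trans ?_ hdim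
  rw [← ENNReal.ofReal_natCast]
  refine ENNReal.ofReal_le_ofReal (le_trans (Finset.sum_le_sum fun x hx => ?_)
    (sum_norm_sq_starProjection_le hb W S))
  have e1 : inner ℂ (b x) (cfc f A (b x)) = inner ℂ (W.starProjection (b x)) (cfc f A (b x)) := by
    rw [Submodule.inner_starProjection_left_eq_right,
      Submodule.starProjection_eq_self_iff.2 (hWmem x hx)]
  have e2 : (inner ℂ (b x) (cfc f A (b x))).re ≤ ‖W.starProjection (b x)‖ * ‖cfc f A (b x)‖ := by
    rw [e1]; exact re_inner_le_norm (𝕜 := ℂ) _ _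
  have e3 := norm_cfc_sq_le (A := A) hf h0 h1 (b x)
  nlinarith [sq_nonneg (‖W.starProjection (b x)‖ - ‖cfc f A (b x)‖),
    norm_nonneg (W.starProjection (b x)), norm_nonneg (cfc f A (b x))]

theorem iUnion_Icc_neg_eq_Iio :
    ⋃ n : ℕ, Set.Icc (-(n : ℝ)) (-(1 / ((n : ℝ) + 1))) = Set.Iio 0 := by
  ext t
  simp only [Set.mem_iUnion, Set.mem_Icc, Set.mem_Iio]
  constructor
  · rintro ⟨n, -, h⟩
    have : (0 : ℝ) < 1 / ((n : ℝ) + 1) := by positivity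
    linarith
  · intro ht
    obtain ⟨n, hn⟩ := exists_nat_ge (max (-t) (1 / (-t)))
    refine ⟨n, by linarith [le_max_left (-t) (1 / (-t))], ?_⟩
    have h1 : 1 / (-t) ≤ (n : ℝ) + 1 := by linarith [le_max_right (-t) (1 / (-t))]
    have h2 : 1 / ((n : ℝ) + 1) ≤ -t := by
      rw [div_le_iff₀ (by linarith)] at h1
      rw [div_le_iff₀ (by positivity)]
      linarith
    linarith

/-- One half of Glazman's lemma: `Tr 1[A < 0]` is at most the largest dimension of a subspace on
which the quadratic form of `A` is negative definite. -/
theorem traceNegProj_le {A : E →L[ℂ] E} (hA : IsSelfAdjoint A) {ι : Type*}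
    (b : HilbertBasis ι ℂ E) {M : ℝ≥0∞}
    (hM : ∀ W : Submodule ℂ E, FiniteDimensional ℂ W →
      (∀ ψ ∈ W, ψ ≠ 0 → (inner ℂ ψ (A ψ)).re < 0) → (Module.finrank ℂ W : ℝ≥0∞) ≤ M) :
    traceNegProj b A ≤ M := by
  unfold traceNegProj
  rw [ENNReal.tsum_eq_iSup_sum]
  refine iSup_le fun S => ?_
  -- The Riesz measure is controlled by compactly supported test functions, so the negative
  -- half-line is exhausted by compact intervals that stay away from 0.
  have hmono : Monotone fun n : ℕ => Set.Icc (-(n : ℝ)) (-(1 / ((n : ℝ) + 1))) := by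
    intro m n hmn
    have h : (m : ℝ) ≤ n := by exact_mod_cast hmn
    refine Set.Icc_subset_Icc (by linarith) (neg_le_neg ?_)
    gcongr
  have hsup : ∀ φ : E, spectralMeasure A φ (Set.Iio 0) =
      ⨆ n : ℕ, spectralMeasure A φ (Set.Icc (-(n : ℝ)) (-(1 / ((n : ℝ) + 1)))) := fun φ => by
    rw [← iUnion_Icc_neg_eq_Iio, hmono.measure_iUnion]
  simp_rw [hsup]
  rw [ENNReal.finsetSum_iSup_of_monotone (f := fun x (n : ℕ) =>
    spectralMeasure A (b x) (Set.Icc (-(n : ℝ)) (-(1 / ((n : ℝ) + 1)))))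
    fun i m n hmn => measure_mono (hmono hmn)]
  refine iSup_le fun n => ?_
  have hn : (0 : ℝ) < 1 / ((n : ℝ) + 1) := by positivity
  obtain ⟨f, hf1, hf0, hfc, hf⟩ := exists_continuous_one_zero_of_isCompact
    (s := Set.Icc (-(n : ℝ)) (-(1 / ((n : ℝ) + 1)))) (t := Set.Ici (-(1 / ((n : ℝ) + 1)) / 2))
    isCompact_Icc isClosed_Ici (by
      rw [Set.disjoint_left]
      rintro t ⟨-, h1⟩ h2
      have := Set.mem_Ici.1 h2
      linarith)
  refine le_trans (Finset.sum_le_sum fun x _ => ?_)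
    (sum_re_inner_cfc_le (ε := 1 / ((n : ℝ) + 1) / 2) (f := f) hA hM f.continuous
      (fun t => (hf t).1) (fun t => (hf t).2) (by positivity)
      (fun t ht => hf0 (Set.mem_Ici.2 (by linarith))) b.orthonormal S)
  exact RealRMK.rieszMeasure_le_of_eq_one (spectralFunctional A (b x)) (f := ⟨f, hfc⟩)
    (fun t => (hf t).1) isCompact_Icc (fun t ht => hf1 ht)

end SpectralProjection

/-! ### Quadratic behaviour of a function at a nondegenerate minimum. -/

section Taylor

open Filter Topology

variable {E : Type*} [NormedAddCommGroup E] [NormedSpace ℝ E]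

/-- Second-order Taylor expansion at a critical point. -/
theorem eventually_abs_taylor_two_le {f : E → ℝ} (hf : ContDiff ℝ 2 f) {x₀ : E}
    (hcrit : fderiv ℝ f x₀ = 0) {ε : ℝ} (hε : 0 < ε) :
    ∀ᶠ x in 𝓝 x₀, |f x - f x₀ - 1 / 2 * fderiv ℝ (fderiv ℝ f) x₀ (x - x₀) (x - x₀)|
      ≤ ε * ‖x - x₀‖ ^ 2 := by
  set A := fderiv ℝ (fderiv ℝ f) x₀ with hAdef
  have hsymm : ∀ u w, A u w = A w u := fun u w =>
    (hf.contDiffAt (x := x₀)).isSymmSndFDerivAt (by simp) u w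
  have hf1 : Differentiable ℝ f := hf.differentiable (by norm_num)
  have hf2 : DifferentiableAt ℝ (fderiv ℝ f) x₀ :=
    ((hf.fderiv_right (m := 1) (by norm_num)).differentiable (by norm_num)) x₀
  have ho := hf2.hasFDerivAt.isLittleO.bound hε
  obtain ⟨r, hr, hball⟩ := Metric.eventually_nhds_iff_ball.1 ho
  refine Metric.eventually_nhds_iff_ball.2 ⟨r, hr, fun x hx => ?_⟩
  -- The derivative of the remainder is the first-order error of `fderiv ℝ f`, hence o(‖y - x₀‖);
  -- the mean value inequality on a ball integrates this bound.
  set R : E → ℝ := fun y => f y - f x₀ - 1 / 2 * A (y - x₀) (y - x₀) with hR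
  have hderiv : ∀ y, HasFDerivAt R (fderiv ℝ f y - A (y - x₀)) y := by
    intro y
    have h1 : HasFDerivAt (fun z => z - x₀) (ContinuousLinearMap.id ℝ E) y :=
      (hasFDerivAt_id y).sub_const x₀
    have h2 : HasFDerivAt (fun z => A (z - x₀)) A y := by
      have h := A.hasFDerivAt.comp y h1
      rwa [ContinuousLinearMap.comp_id] at h
    have h3 := ((h2.clm_apply h1).const_mul (1 / 2))
    have h4 := ((hf1 y).hasFDerivAt.sub_const (f x₀)).sub h3
    refine h4.congr_fderiv ?_
    ext w
    simp only [sub_apply, smul_apply, add_apply, ContinuousLinearMap.comp_apply,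
      ContinuousLinearMap.id_apply, ContinuousLinearMap.flip_apply, hsymm w (y - x₀), smul_eq_mul]
    ring
  have hseg := (convex_closedBall x₀ ‖x - x₀‖).norm_image_sub_le_of_norm_hasFDerivWithin_le
    (f := R) (f' := fun y => fderiv ℝ f y - A (y - x₀)) (C := ε * ‖x - x₀‖)
    (fun y _ => (hderiv y).hasFDerivWithinAt) (fun y hy => ?_)
    (Metric.mem_closedBall_self (norm_nonneg _)) (y := x) (by simp [dist_eq_norm])
  · have h0 : R x₀ = 0 := by simp [hR]
    rw [h0, sub_zero, Real.norm_eq_abs] at hseg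
    calc _ ≤ _ := hseg
      _ = _ := by ring
  · rw [Metric.mem_closedBall, dist_eq_norm] at hy
    rw [Metric.mem_ball, dist_eq_norm] at hx
    have := hball y (by rw [Metric.mem_ball, dist_eq_norm]; linarith)
    rw [hcrit, sub_zero] at this
    exact this.trans (mul_le_mul_of_nonneg_left hy hε.le)

theorem eventually_le_mul_norm_sq {f : E → ℝ} (hf : ContDiff ℝ 2 f) {x₀ : E}
    (hcrit : fderiv ℝ f x₀ = 0) (h0 : f x₀ = 0) :
    ∃ K : ℝ, 0 < K ∧ ∀ᶠ x in 𝓝 x₀, f x ≤ K * ‖x - x₀‖ ^ 2 := by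
  refine ⟨1 / 2 * ‖fderiv ℝ (fderiv ℝ f) x₀‖ + 1, by positivity, ?_⟩
  filter_upwards [eventually_abs_taylor_two_le hf hcrit one_pos] with x hx
  have h1 : fderiv ℝ (fderiv ℝ f) x₀ (x - x₀) (x - x₀) ≤
      ‖fderiv ℝ (fderiv ℝ f) x₀‖ * ‖x - x₀‖ * ‖x - x₀‖ :=
    (le_abs_self _).trans (ContinuousLinearMap.le_opNorm₂ (fderiv ℝ (fderiv ℝ f) x₀) _ _)
  have := (abs_le.1 hx).2
  nlinarith

theorem hessian_nonneg_of_min {f : E → ℝ} (hf : ContDiff ℝ 2 f) {x₀ : E}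
    (hcrit : fderiv ℝ f x₀ = 0) (hmin : ∀ x, f x₀ ≤ f x) (u : E) :
    0 ≤ fderiv ℝ (fderiv ℝ f) x₀ u u := by
  by_contra! hneg
  rcases eq_or_ne u 0 with rfl | hu
  · simp at hneg
  have hn : 0 < ‖u‖ := norm_pos_iff.2 hu
  set a := fderiv ℝ (fderiv ℝ f) x₀ u u with ha
  -- With this ε the error along t • u is at most half the size of the negative quadratic term a
  -- t²/2.
  have hev := eventually_abs_taylor_two_le hf hcrit (ε := -a / (4 * ‖u‖ ^ 2))
    (div_pos (by linarith) (by positivity))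
  have hlim : Tendsto (fun t : ℝ => x₀ + t • u) (𝓝[>] 0) (𝓝 x₀) := by
    have : Continuous fun t : ℝ => x₀ + t • u := by fun_prop
    have := this.tendsto 0
    simp only [zero_smul, add_zero] at this
    exact this.mono_left nhdsWithin_le_nhds
  obtain ⟨t, ht, ht0⟩ := ((hlim.eventually hev).and self_mem_nhdsWithin).exists
  replace ht0 : 0 < t := ht0
  simp only [add_sub_cancel_left, map_smul, smul_apply, smul_eq_mul, norm_smul] at ht
  have h1 := (abs_le.1 ht).2
  rw [← ha] at h1
  have h2 : -a / (4 * ‖u‖ ^ 2) * (‖t‖ * ‖u‖) ^ 2 = -a / 4 * t ^ 2 := by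
    rw [Real.norm_eq_abs, mul_pow, sq_abs]; field_simp
  rw [h2] at h1
  have := hmin (x₀ + t • u)
  nlinarith [pow_pos ht0 2]

/-- A positive semidefinite nondegenerate form is definite, and compactness of the unit sphere makes
it coercive; half of the quadratic term then absorbs the Taylor error. -/
theorem eventually_mul_norm_sq_le [FiniteDimensional ℝ E] {f : E → ℝ} (hf : ContDiff ℝ 2 f) {x₀ : E}
    (hcrit : fderiv ℝ f x₀ = 0) (h0 : f x₀ = 0) (hmin : ∀ x, 0 ≤ f x)
    (hnd : ∀ u, (∀ w, fderiv ℝ (fderiv ℝ f) x₀ u w = 0) → u = 0) :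
    ∃ c : ℝ, 0 < c ∧ ∀ᶠ x in 𝓝 x₀, c * ‖x - x₀‖ ^ 2 ≤ f x := by
  set A := fderiv ℝ (fderiv ℝ f) x₀ with hA
  have hsymm : ∀ u w, A u w = A w u := fun u w =>
    (hf.contDiffAt (x := x₀)).isSymmSndFDerivAt (by simp) u w
  have hnn : ∀ u, 0 ≤ A u u := hessian_nonneg_of_min hf hcrit (by simpa [h0] using hmin)
  have hpos : ∀ u, u ≠ 0 → 0 < A u u := by
    intro u hu
    refine (hnn u).lt_of_ne fun h => hu (hnd u fun w => ?_)
    by_contra hw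
    -- Moving from an isotropic u towards w would make the form negative. The added 1 avoids
    -- dividing by zero when A w w = 0.
    have h1 := hnn (u + (-(A u w) / (A w w + 1)) • w)
    have h2 := hnn w
    simp only [map_add, map_smul, add_apply, smul_apply, smul_eq_mul, ← h, hsymm w u] at h1
    have h3 : 0 < A w w + 1 := by linarith
    have h4 : 0 < A u w ^ 2 := by positivity
    have h5 : 0 + -(A u w) / (A w w + 1) * A u w + (-(A u w) / (A w w + 1) * A u w +
        -(A u w) / (A w w + 1) * (-(A u w) / (A w w + 1) * A w w))
        = -(A u w ^ 2 * (A w w + 2)) / (A w w + 1) ^ 2 := by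
      field_simp; ring
    have h6 : -(A u w ^ 2 * (A w w + 2)) / (A w w + 1) ^ 2 < 0 :=
      div_neg_of_neg_of_pos (by nlinarith) (by positivity)
    linarith
  obtain ⟨m, hm, hmle⟩ : ∃ m : ℝ, 0 < m ∧ ∀ u, m * ‖u‖ ^ 2 ≤ A u u := by
    rcases subsingleton_or_nontrivial E with hE | hE
    · exact ⟨1, one_pos, fun u => by simp [Subsingleton.elim u 0]⟩
    have := FiniteDimensional.proper ℝ E
    obtain ⟨v, hv, hvmin⟩ := (isCompact_sphere (0 : E) 1).exists_isMinOn
      (NormedSpace.sphere_nonempty.2 zero_le_one) (f := fun u => A u u)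
      (by fun_prop)
    have hv0 : v ≠ 0 := by rintro rfl; simp at hv
    refine ⟨A v v, hpos v hv0, fun u => ?_⟩
    rcases eq_or_ne u 0 with rfl | hu
    · simp
    have hn : 0 < ‖u‖ := norm_pos_iff.2 hu
    have h1 : A v v ≤ A (‖u‖⁻¹ • u) (‖u‖⁻¹ • u) :=
      hvmin (by simp [norm_smul, hn.ne'])
    simp only [map_smul, smul_apply, smul_eq_mul] at h1
    calc A v v * ‖u‖ ^ 2 ≤ (‖u‖⁻¹ * (‖u‖⁻¹ * A u u)) * ‖u‖ ^ 2 := by gcongr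
      _ = A u u := by field_simp
  refine ⟨m / 4, by positivity, ?_⟩
  filter_upwards [eventually_abs_taylor_two_le hf hcrit (ε := m / 4) (by positivity)] with x hx
  have h1 := (abs_le.1 hx).1
  have h2 := hmle (x - x₀)
  rw [h0] at h1
  linarith

end Taylor

/-! ### Two-sided volume bounds for sublevel sets on the torus. -/

section Torus

theorem ofReal_two_mul_div_pow {a : ℝ} (ha : 0 ≤ a) (s : ℝ≥0) (n : ℕ) :
    ENNReal.ofReal ((2 * ((s : ℝ) / a)) ^ n)
      = ((Real.toNNReal (2 / a) ^ n : ℝ≥0) : ℝ≥0∞) * (s : ℝ≥0∞) ^ n := by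
  rw [show 2 * ((s : ℝ) / a) = 2 / a * s by ring, ENNReal.ofReal_pow (by positivity),
    ENNReal.ofReal_mul (by positivity), ENNReal.ofReal_coe_nnreal, mul_pow, ENNReal.coe_pow]
  rfl

variable {d : ℕ}

theorem measurePreserving_torus_mk (a : Fin d → ℝ) :
    MeasurePreserving (fun (q : Fin d → ℝ) (i : Fin d) => ((q i : ℝ) : UnitAddCircle))
      (volume.restrict (Set.univ.pi fun i => Set.Ioc (a i) (a i + 1))) (haarTorus d) := by
  rw [volume_pi, Measure.restrict_pi_pi]
  have h : (volume : Measure UnitAddCircle) = AddCircle.haarAddCircle := by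
    rw [AddCircle.volume_eq_smul_haarAddCircle]; simp
  refine measurePreserving_pi _ _ fun i => ?_
  rw [← h]
  exact UnitAddCircle.measurePreserving_mk (a i)

theorem ofMomentum_two_pi_smul (q : Fin d → ℝ) :
    ofMomentum ((2 * Real.pi) • q) = fun i => ((q i : ℝ) : UnitAddCircle) := by
  ext i
  have : (2 * Real.pi) ≠ 0 := by positivity
  simp only [ofMomentum, Pi.smul_apply, smul_eq_mul]
  rw [mul_div_cancel_left₀ _ this]

theorem ofMomentum_surjective : Function.Surjective (ofMomentum (d := d)) := by
  intro k
  choose q hq using fun i => QuotientAddGroup.mk_surjective (k i)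
  exact ⟨(2 * Real.pi) • q, by rw [ofMomentum_two_pi_smul]; exact funext hq⟩

variable {e : C(DualTorus d, ℝ)}

theorem IsAdmissible.nonneg (he : IsAdmissible e) (k : DualTorus d) : 0 ≤ e k := by
  obtain ⟨m, hm⟩ := he.range_eq
  exact (hm ▸ Set.mem_range_self k : e k ∈ Set.Icc 0 m).1

theorem IsAdmissible.exists_eq_zero (he : IsAdmissible e) : ∃ k, e k = 0 := by
  obtain ⟨m, hm⟩ := he.range_eq
  have h0 : e 0 ∈ Set.Icc 0 m := hm ▸ Set.mem_range_self 0
  have : (0 : ℝ) ∈ Set.range e := by rw [hm]; exact ⟨le_rfl, h0.1.trans h0.2⟩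
  exact this

theorem IsAdmissible.fderiv_eq_zero (he : IsAdmissible e) {p : Fin d → ℝ}
    (hp : e (ofMomentum p) = 0) : fderiv ℝ (fun q => e (ofMomentum q)) p = 0 :=
  IsLocalMin.fderiv_eq_zero (Filter.Eventually.of_forall fun q => by
    simpa [hp] using he.nonneg (ofMomentum q))

open Filter Topology in
theorem eventually_comp_smul_sub {P : ℝ → (Fin d → ℝ) → Prop} {c : ℝ} (hc : 0 < c) {q₀ : Fin d → ℝ}
    (h : ∀ᶠ p in 𝓝 (c • q₀), P ‖p - c • q₀‖ p) :
    ∀ᶠ q in 𝓝 q₀, P (c * ‖q - q₀‖) (c • q) := by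
  have hlim : Tendsto (fun q : Fin d → ℝ => c • q) (𝓝 q₀) (𝓝 (c • q₀)) :=
    (continuous_const_smul c).tendsto q₀
  filter_upwards [hlim.eventually h] with q hq
  rwa [← smul_sub, norm_smul, Real.norm_eq_abs, abs_of_pos hc] at hq

open Filter Topology in
-- Near a zero of `e`, quadratic growth confines the sublevel set to a sup-norm ball of radius
-- proportional to s. Elsewhere `e` exceeds some δ > 0 locally: the set is empty for s ≤ √δ, and for
-- larger s the volume of a unit ball is already at most a multiple of s^d.
theorem IsAdmissible.exists_nhds_sublevel_le (he : IsAdmissible e) (q₀ : Fin d → ℝ) :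
    ∃ U ∈ 𝓝 q₀, ∃ C : ℝ≥0, ∀ s : ℝ≥0,
      volume (U ∩ {q : Fin d → ℝ | e (ofMomentum ((2 * Real.pi) • q)) < (s : ℝ) ^ 2})
        ≤ C * (s : ℝ≥0∞) ^ d := by
  have hpi : 0 < 2 * Real.pi := by positivity
  have hcont : Continuous fun p : Fin d → ℝ => e (ofMomentum p) := he.morse.contDiff.continuous
  rcases (he.nonneg (ofMomentum ((2 * Real.pi) • q₀))).eq_or_lt with h0 | hpos
  · obtain ⟨c, hc, hev⟩ := eventually_mul_norm_sq_le he.morse.contDiff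
      (he.fderiv_eq_zero h0.symm) h0.symm (fun p => he.nonneg _)
      (he.morse.nondegenerate _ (he.fderiv_eq_zero h0.symm))
    have hev' := eventually_comp_smul_sub
      (P := fun t p => c * t ^ 2 ≤ e (ofMomentum p)) hpi hev
    set a : ℝ := √c * (2 * Real.pi) with ha
    have hapos : 0 < a := mul_pos (Real.sqrt_pos.2 hc) hpi
    refine ⟨_, hev', (Real.toNNReal (2 / a)) ^ d, fun s => ?_⟩
    have hsub : {q : Fin d → ℝ | c * (2 * Real.pi * ‖q - q₀‖) ^ 2 ≤ e (ofMomentum ((2 * Real.pi) • q))} ∩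
        {q : Fin d → ℝ | e (ofMomentum ((2 * Real.pi) • q)) < (s : ℝ) ^ 2} ⊆
        Metric.closedBall q₀ (s / a) := by
      rintro q ⟨h1, h2⟩
      simp only [Set.mem_ofPred_eq] at h1 h2
      rw [Metric.mem_closedBall, dist_eq_norm, le_div_iff₀ hapos]
      refine (abs_le_of_sq_le_sq' (a := ‖q - q₀‖ * a) ?_ s.2).2
      calc (‖q - q₀‖ * a) ^ 2 = c * (2 * Real.pi * ‖q - q₀‖) ^ 2 := by
            rw [ha, mul_pow, mul_pow, Real.sq_sqrt hc.le]; ring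
        _ ≤ _ := h1.trans h2.le
    refine (measure_mono hsub).trans (le_of_eq ?_)
    rw [Real.volume_pi_closedBall _ (by positivity), Fintype.card_fin]
    exact ofReal_two_mul_div_pow hapos.le s d
  · set δ := e (ofMomentum ((2 * Real.pi) • q₀)) / 2 with hδ
    have hev : ∀ᶠ q in 𝓝 q₀, δ < e (ofMomentum ((2 * Real.pi) • q)) :=
      (hcont.comp (continuous_const_smul (2 * Real.pi))).continuousAt.eventually_const_lt
        (by simp only [Function.comp]; linarith)
    refine ⟨_, inter_mem hev (Metric.closedBall_mem_nhds q₀ one_pos),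
      (Real.toNNReal (2 / √δ)) ^ d, fun s => ?_⟩
    have hδ0 : 0 < √δ := Real.sqrt_pos.2 (by linarith)
    rcases le_or_gt (s : ℝ) √δ with hs | hs
    · have hs2 : (s : ℝ) ^ 2 ≤ δ := by
        rw [← Real.sq_sqrt (by linarith : 0 ≤ δ)]; gcongr
      refine le_trans (le_of_eq ?_) zero_le
      convert measure_empty (μ := (volume : Measure (Fin d → ℝ)))
      ext q
      simp only [Set.mem_inter_iff, Set.mem_ofPred_eq, Set.mem_empty_iff_false, iff_false]
      rintro ⟨⟨h1, -⟩, h2⟩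
      linarith
    · refine (measure_mono (t := Metric.closedBall q₀ 1) fun q hq => hq.1.2).trans ?_
      rw [Real.volume_pi_closedBall _ zero_le_one, Fintype.card_fin]
      rw [← ofReal_two_mul_div_pow hδ0.le]
      refine ENNReal.ofReal_le_ofReal (pow_le_pow_left₀ (by norm_num) ?_ _)
      gcongr
      rw [le_div_iff₀ hδ0]
      linarith

theorem IsAdmissible.exists_sublevel_le (he : IsAdmissible e) :
    ∃ C : ℝ≥0, ∀ s : ℝ≥0, haarTorus d {k | e k < (s : ℝ) ^ 2} ≤ C * (s : ℝ≥0∞) ^ d := by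
  have hcpt : IsCompact (Set.univ.pi fun _ : Fin d => Set.Icc (0 : ℝ) 1) :=
    isCompact_univ_pi fun _ => isCompact_Icc
  -- The local bounds are patched over the compact unit cube; the constants add under unions.
  obtain ⟨C, hC⟩ := hcpt.induction_on (p := fun U => ∃ C : ℝ≥0, ∀ s : ℝ≥0,
      volume (U ∩ {q : Fin d → ℝ | e (ofMomentum ((2 * Real.pi) • q)) < (s : ℝ) ^ 2})
        ≤ C * (s : ℝ≥0∞) ^ d) ⟨0, by simp⟩
    (fun U W hUW ⟨C, hC⟩ => ⟨C, fun s =>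
      (measure_mono (Set.inter_subset_inter_left _ hUW)).trans (hC s)⟩)
    (fun U W ⟨C, hC⟩ ⟨C', hC'⟩ => ⟨C + C', fun s => by
      rw [Set.union_inter_distrib_right, ENNReal.coe_add, add_mul]
      exact (measure_union_le _ _).trans (add_le_add (hC s) (hC' s))⟩)
    (fun q _ => by
      obtain ⟨U, hU, C, hC⟩ := he.exists_nhds_sublevel_le q
      exact ⟨U, mem_nhdsWithin_of_mem_nhds hU, C, hC⟩)
  refine ⟨C, fun s => ?_⟩
  have hmeas : MeasurableSet {k : DualTorus d | e k < (s : ℝ) ^ 2} :=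
    measurableSet_lt e.continuous.measurable measurable_const
  have hmp := measurePreserving_torus_mk (d := d) 0
  rw [← hmp.measure_preimage hmeas.nullMeasurableSet,
    Measure.restrict_apply (hmp.measurable hmeas), Set.inter_comm]
  refine (measure_mono ?_).trans (hC s)
  rintro q ⟨h1, h2⟩
  refine ⟨fun i hi => ?_, ?_⟩
  · have := h1 i hi
    simp only [Pi.zero_apply, zero_add] at this
    exact ⟨this.1.le, this.2⟩
  · simpa [ofMomentum_two_pi_smul] using h2

theorem IsAdmissible.exists_le_sublevel (he : IsAdmissible e) :
    ∃ c s₀ : ℝ≥0, 0 < c ∧ 0 < s₀ ∧ ∀ s, 0 < s → s ≤ s₀ →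
      c * (s : ℝ≥0∞) ^ d ≤ haarTorus d {k | e k < (s : ℝ) ^ 2} := by
  have hpi : 0 < 2 * Real.pi := by positivity
  obtain ⟨k, hk⟩ := he.exists_eq_zero
  obtain ⟨p, rfl⟩ := ofMomentum_surjective k
  obtain ⟨q₀, rfl⟩ : ∃ q, p = (2 * Real.pi) • q := ⟨(2 * Real.pi)⁻¹ • p, by
    rw [smul_inv_smul₀ hpi.ne']⟩
  obtain ⟨K, hK, hev⟩ := eventually_le_mul_norm_sq he.morse.contDiff (he.fderiv_eq_zero hk) hk
  obtain ⟨r, hr, hball⟩ := Metric.eventually_nhds_iff_ball.1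
    (eventually_comp_smul_sub (P := fun t p => e (ofMomentum p) ≤ K * t ^ 2) hpi hev)
  set a : ℝ := √K * (2 * Real.pi) with ha
  have hapos : 0 < a := mul_pos (Real.sqrt_pos.2 hK) hpi
  have hmin : 0 < min r (1 / 2) := lt_min hr (by norm_num)
  -- For s ≤ s₀ the ball of radius s/a lies both in the region of the Taylor bound and in the
  -- fundamental cube centred at q₀, so it injects into the torus.
  refine ⟨(Real.toNNReal (2 / a)) ^ d, Real.toNNReal (min r (1 / 2) * a),
    pow_pos (Real.toNNReal_pos.2 (by positivity)) d,
    Real.toNNReal_pos.2 (mul_pos hmin hapos), fun s hspos hs => ?_⟩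
  have hs' : (s : ℝ) / a ≤ min r (1 / 2) := by
    rw [div_le_iff₀ hapos]
    exact (Real.le_toNNReal_iff_coe_le (by positivity)).1 hs
  have hmeas : MeasurableSet {k : DualTorus d | e k < (s : ℝ) ^ 2} :=
    measurableSet_lt e.continuous.measurable measurable_const
  have hmp := measurePreserving_torus_mk (d := d) fun i => q₀ i - 1 / 2
  rw [← hmp.measure_preimage hmeas.nullMeasurableSet,
    Measure.restrict_apply (hmp.measurable hmeas)]
  calc _ = volume (Metric.ball q₀ (s / a)) := by
        rw [Real.volume_pi_ball _ (div_pos (NNReal.coe_pos.2 hspos) hapos), Fintype.card_fin]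
        exact (ofReal_two_mul_div_pow hapos.le s d).symm
    _ ≤ _ := measure_mono fun q hq => ?_
  rw [Metric.mem_ball] at hq
  constructor
  · have h1 := hball q (Metric.mem_ball.2 (hq.trans_le (hs'.trans (min_le_left _ _))))
    simp only [Set.mem_preimage, Set.mem_ofPred_eq, ← ofMomentum_two_pi_smul]
    refine h1.trans_lt ?_
    rw [dist_eq_norm, lt_div_iff₀ hapos] at hq
    calc K * (2 * Real.pi * ‖q - q₀‖) ^ 2 = (‖q - q₀‖ * a) ^ 2 := by
          rw [ha, mul_pow _ (√K * _), mul_pow √K, Real.sq_sqrt hK.le]; ring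
      _ < (s : ℝ) ^ 2 := by gcongr
  · intro i _
    have h1 : |q i - q₀ i| < 1 / 2 :=
      ((dist_le_pi_dist q q₀ i).trans_lt hq).trans_le (hs'.trans (min_le_right _ _))
    rw [abs_lt] at h1
    constructor <;> linarith

end Torus

/-! ### Density estimates for orthonormal systems by the Rumin–Frank method. -/

section RuminFrank

theorem enorm_add_sq_le {E : Type*} [SeminormedAddCommGroup E] (a b : E) :
    ‖a + b‖ₑ ^ 2 ≤ 2 * ‖a‖ₑ ^ 2 + 2 * ‖b‖ₑ ^ 2 := by
  have h : ‖a + b‖₊ ^ 2 ≤ 2 * ‖a‖₊ ^ 2 + 2 * ‖b‖₊ ^ 2 := by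
    have h1 : ‖a + b‖ ^ 2 ≤ 2 * ‖a‖ ^ 2 + 2 * ‖b‖ ^ 2 := by
      nlinarith [norm_add_le a b, norm_nonneg (a + b), sq_nonneg (‖a‖ - ‖b‖)]
    exact_mod_cast h1
  simp only [enorm_eq_nnnorm]
  exact_mod_cast h

/-- Superadditivity of the lower integral suffices, so the coefficients need not be shown measurable
in the energy cut-off. -/
theorem tsum_lintegral_le {ι α : Type*} [MeasurableSpace α] (μ : Measure α)
    (f : ι → α → ℝ≥0∞) : ∑' i, ∫⁻ a, f i a ∂μ ≤ ∫⁻ a, ∑' i, f i a ∂μ := by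
  classical
  rw [ENNReal.tsum_eq_iSup_sum]
  refine iSup_le fun S => ?_
  have h : ∑ i ∈ S, ∫⁻ a, f i a ∂μ ≤ ∫⁻ a, ∑ i ∈ S, f i a ∂μ := by
    induction S using Finset.induction_on with
    | empty => simp
    | insert i S hi ih =>
      simp only [Finset.sum_insert hi]
      exact (add_le_add le_rfl ih).trans (le_lintegral_add _ _)
  exact h.trans (lintegral_mono fun a => ENNReal.sum_le_tsum S)

variable {X : Type*} [MeasurableSpace X] {μ : Measure X}

/-- The diagonal `∫_{e < t} 1 / e` of the inverse of the multiplier `e` cut off at energies below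
`t`. -/
def lowEnergyInverse (μ : Measure X) (e : X → ℝ) (t : ℝ) : ℝ≥0∞ :=
  ∫⁻ k in {k | e k < t}, (ENNReal.ofReal (e k))⁻¹ ∂μ

/-- Decompose {e < s²} dyadically by 4^n ≤ s²/e < 4^{n+1}. Level n contributes at most 4^{n+1} C
(2s/2^n)^d, and d ≥ 3 makes this summable with ratio 1/2. -/
theorem mul_lowEnergyInverse_le {e : X → ℝ} (he : Measurable e) (hpos : ∀ᵐ k ∂μ, 0 < e k)
    {C : ℝ≥0} {d : ℕ} (hd : 3 ≤ d)
    (hC : ∀ s : ℝ≥0, μ {k | e k < (s : ℝ) ^ 2} ≤ C * (s : ℝ≥0∞) ^ d) (s : ℝ≥0) :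
    (s : ℝ≥0∞) ^ 2 * lowEnergyInverse μ e ((s : ℝ) ^ 2) ≤ 8 * C * (2 * s) ^ d := by
  have hmeas : ∀ t : ℝ, MeasurableSet {k | e k < t} := fun t => measurableSet_lt he measurable_const
  have hpt : ∀ᵐ k ∂μ, k ∈ {k | e k < (s : ℝ) ^ 2} →
      (s : ℝ≥0∞) ^ 2 * (ENNReal.ofReal (e k))⁻¹ ≤
        ∑' n : ℕ, Set.indicator {k | e k < ((2 * s / 2 ^ n : ℝ≥0) : ℝ) ^ 2}
          (fun _ => (4 : ℝ≥0∞) ^ (n + 1)) k := by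
    filter_upwards [hpos] with k hk hks
    replace hks : e k < (s : ℝ) ^ 2 := hks
    obtain ⟨n, hn1, hn2⟩ := exists_nat_pow_near (x := (s : ℝ) ^ 2 / e k) (y := 4)
      ((one_le_div hk).2 hks.le) (by norm_num)
    refine le_trans ?_ (ENNReal.le_tsum n)
    -- The factor 2 turns e ≤ s²/4^n into a strict inequality.
    have hmem : k ∈ {k | e k < ((2 * s / 2 ^ n : ℝ≥0) : ℝ) ^ 2} := by
      simp only [Set.mem_ofPred_eq]
      push_cast
      rw [le_div_iff₀ hk] at hn1
      rw [div_pow, lt_div_iff₀ (by positivity), ← pow_mul, mul_comm n 2, pow_mul]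
      norm_num
      nlinarith
    rw [Set.indicator_of_mem hmem, ← div_eq_mul_inv,
      ← ENNReal.ofReal_coe_nnreal (p := s), ← ENNReal.ofReal_pow s.coe_nonneg, ← ENNReal.ofReal_div_of_pos hk]
    calc _ ≤ ENNReal.ofReal (4 ^ (n + 1)) := ENNReal.ofReal_le_ofReal hn2.le
      _ = _ := by rw [ENNReal.ofReal_pow (by norm_num)]; norm_num
  have hterm : ∀ n : ℕ, (4 : ℝ≥0∞) ^ (n + 1) * (C * ((2 * s / 2 ^ n : ℝ≥0) : ℝ≥0∞) ^ d) ≤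
      4 * C * (2 * s) ^ d * (2⁻¹ : ℝ≥0∞) ^ n := by
    intro n
    have h : (4 : ℝ≥0) ^ (n + 1) * (C * (2 * s / 2 ^ n) ^ d) ≤
        4 * C * (2 * s) ^ d * (2⁻¹ : ℝ≥0) ^ n := by
      have h1 : (4 : ℝ≥0) ^ (n + 1) * (C * (2 * s / 2 ^ n) ^ d) =
          4 * C * (2 * s) ^ d * (4 ^ n / (2 ^ n) ^ d) := by
        rw [div_pow]; ring
      rw [h1]
      gcongr
      rw [div_le_iff₀ (by positivity), inv_pow]
      have h2 : ((2 : ℝ≥0) ^ n) ^ 3 ≤ (2 ^ n) ^ d :=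
        pow_le_pow_right₀ (one_le_pow₀ (by norm_num)) hd
      calc (4 : ℝ≥0) ^ n = (2 ^ n)⁻¹ * (2 ^ n) ^ 3 := by
            have : (2 : ℝ≥0) ^ n ≠ 0 := by positivity
            rw [show (4 : ℝ≥0) = 2 ^ 2 by norm_num, ← pow_mul, mul_comm 2 n, pow_mul]
            field_simp
        _ ≤ _ := by gcongr
    have h3 := ENNReal.coe_le_coe.2 h
    push_cast at h3 ⊢
    simpa using h3
  calc (s : ℝ≥0∞) ^ 2 * lowEnergyInverse μ e ((s : ℝ) ^ 2)
      = ∫⁻ k in {k | e k < (s : ℝ) ^ 2}, (s : ℝ≥0∞) ^ 2 * (ENNReal.ofReal (e k))⁻¹ ∂μ := by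
        rw [lintegral_const_mul _ (by fun_prop)]; rfl
    _ ≤ ∫⁻ k in {k | e k < (s : ℝ) ^ 2}, ∑' n : ℕ, Set.indicator
          {k | e k < ((2 * s / 2 ^ n : ℝ≥0) : ℝ) ^ 2} (fun _ => (4 : ℝ≥0∞) ^ (n + 1)) k ∂μ := by
        refine lintegral_mono_ae ?_
        rwa [ae_restrict_iff' (hmeas _)]
    _ ≤ ∫⁻ k, ∑' n : ℕ, Set.indicator
          {k | e k < ((2 * s / 2 ^ n : ℝ≥0) : ℝ) ^ 2} (fun _ => (4 : ℝ≥0∞) ^ (n + 1)) k ∂μ :=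
        setLIntegral_le_lintegral _ _
    _ = ∑' n : ℕ, 4 ^ (n + 1) * μ {k | e k < ((2 * s / 2 ^ n : ℝ≥0) : ℝ) ^ 2} := by
        rw [lintegral_tsum fun n => (measurable_const.indicator (hmeas _)).aemeasurable]
        simp_rw [lintegral_indicator_const (hmeas _)]
    _ ≤ ∑' n : ℕ, 4 * C * (2 * s) ^ d * (2⁻¹ : ℝ≥0∞) ^ n :=
        ENNReal.tsum_le_tsum fun n => le_trans (by gcongr; exact hC _) (hterm n)
    _ = 8 * C * (2 * s) ^ d := by
        rw [ENNReal.tsum_mul_left, ENNReal.tsum_geometric, ENNReal.one_sub_inv_two, inv_inv]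
        ring

theorem lintegral_enorm_sq_eq (f : Lp ℂ 2 μ) : ∫⁻ k, ‖f k‖ₑ ^ 2 ∂μ = ‖f‖ₑ ^ 2 := by
  rw [Lp.enorm_def, eLpNorm_eq_lintegral_rpow_enorm_toReal (by norm_num) (by norm_num)]
  simp only [ENNReal.toReal_ofNat, ENNReal.rpow_ofNat]
  rw [← ENNReal.rpow_natCast, ← ENNReal.rpow_mul]
  norm_num

theorem enorm_sq_eq_ofReal {E : Type*} [SeminormedAddCommGroup E] (z : E) :
    ‖z‖ₑ ^ 2 = ENNReal.ofReal (‖z‖ ^ 2) := by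
  rw [ENNReal.ofReal_pow (norm_nonneg _), ofReal_norm]

theorem tsum_enorm_sq_inner {ι E : Type*} [NormedAddCommGroup E] [InnerProductSpace ℂ E]
    (b : HilbertBasis ι ℂ E) (f : E) : ∑' x, ‖inner ℂ (b x) f‖ₑ ^ 2 = ‖f‖ₑ ^ 2 := by
  have h1 : HasSum (fun x => ‖inner ℂ (b x) f‖ ^ 2) (‖f‖ ^ 2) := by
    have h2 := Complex.hasSum_re (b.hasSum_inner_mul_inner f f)
    convert h2 using 2 with x
    · rw [← inner_conj_symm f (b x), Complex.conj_mul', ← Complex.ofReal_pow, Complex.ofReal_re]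
    · exact (inner_self_eq_norm_sq (𝕜 := ℂ) f).symm
  simp_rw [enorm_sq_eq_ofReal]
  rw [← h1.tsum_eq, ENNReal.ofReal_tsum_of_nonneg (fun x => sq_nonneg _) h1.summable]

theorem sum_enorm_sq_inner_le {ι : Type*} [Fintype ι] {E : Type*} [NormedAddCommGroup E]
    [InnerProductSpace ℂ E] {u : ι → E} (hu : Orthonormal ℂ u) (y : E) :
    ∑ i, ‖inner ℂ y (u i)‖ₑ ^ 2 ≤ ‖y‖ₑ ^ 2 := by
  have h := hu.sum_inner_products_le y (s := Finset.univ)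
  simp only [norm_inner_symm _ y] at h
  simp_rw [enorm_sq_eq_ofReal]
  rw [← ENNReal.ofReal_sum_of_nonneg fun i _ => sq_nonneg _]
  exact ENNReal.ofReal_le_ofReal h

/-- Cut-off of `f ∈ L²` to energies at least `t`. -/
def highEnergyPart {e : X → ℝ} (he : Measurable e) (t : ℝ) (f : Lp ℂ 2 μ) : Lp ℂ 2 μ :=
  ((Lp.memLp f).indicator (measurableSet_le (measurable_const (a := t)) he)).toLp

theorem coeFn_highEnergyPart {e : X → ℝ} (he : Measurable e) (t : ℝ) (f : Lp ℂ 2 μ) :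
    highEnergyPart he t f =ᵐ[μ] Set.indicator {k | t ≤ e k} f :=
  MemLp.coeFn_toLp _

variable {ι κ : Type*} [Fintype κ]

/-- Rumin's estimate for the density of an orthonormal system with respect to the form `e`, with
the low-energy part controlled by Bessel's inequality. -/
theorem density_le {e : X → ℝ} (he : Measurable e) (hpos : ∀ᵐ k ∂μ, 0 < e k)
    {b : Lp ℂ 2 μ} (hb : ∀ᵐ k ∂μ, ‖b k‖ ≤ 1) {g u : κ → Lp ℂ 2 μ} (hu : Orthonormal ℂ u)
    (hgu : ∀ i, u i =ᵐ[μ] fun k => (√(e k) : ℂ) * g i k) (t : ℝ) :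
    ∑ i, ‖inner ℂ b (g i)‖ₑ ^ 2 ≤
      2 * ∑ i, ‖inner ℂ b (highEnergyPart he t (g i))‖ₑ ^ 2 + 2 * lowEnergyInverse μ e t := by
  rcases eq_or_ne (lowEnergyInverse μ e t) ∞ with htop | hfin
  · simp [htop]
  have hmeas : MeasurableSet {k | e k < t} := measurableSet_lt he measurable_const
  -- Moving √e from g to b turns the low-energy coefficient of g into ⟨y₀, u⟩, to which Bessel's
  -- inequality for the orthonormal u applies.
  set y₀ : X → ℂ := Set.indicator {k | e k < t} fun k => ((√(e k))⁻¹ : ℂ) * b k with hy₀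
  have hy₀m : AEStronglyMeasurable y₀ μ := by
    refine AEStronglyMeasurable.indicator (AEStronglyMeasurable.mul ?_ (Lp.aestronglyMeasurable b))
      hmeas
    exact (Complex.measurable_ofReal.comp
      (Real.continuous_sqrt.measurable.comp he)).inv.aestronglyMeasurable
  have hy₀n : ∫⁻ k, ‖y₀ k‖ₑ ^ 2 ∂μ ≤ lowEnergyInverse μ e t := by
    rw [lowEnergyInverse, ← lintegral_indicator hmeas]
    refine lintegral_mono_ae ?_
    filter_upwards [hpos, hb] with k hk hbk
    by_cases hkt : k ∈ {k | e k < t}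
    · rw [hy₀, Set.indicator_of_mem hkt, Set.indicator_of_mem hkt, ← ENNReal.ofReal_inv_of_pos hk,
        ← ofReal_norm, ← ENNReal.ofReal_pow (norm_nonneg _)]
      refine ENNReal.ofReal_le_ofReal ?_
      rw [norm_mul, mul_pow, norm_inv, Complex.norm_real, Real.norm_eq_abs,
        abs_of_nonneg (Real.sqrt_nonneg _), inv_pow, Real.sq_sqrt hk.le]
      exact mul_le_of_le_one_right (inv_nonneg.2 hk.le) (pow_le_one₀ (norm_nonneg _) hbk)
    · rw [hy₀, Set.indicator_of_notMem hkt]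
      simp
  have hy₀L : MemLp y₀ 2 μ := by
    refine ⟨hy₀m, ?_⟩
    rw [eLpNorm_lt_top_iff_lintegral_rpow_enorm_lt_top (by norm_num) (by norm_num)]
    simp only [ENNReal.toReal_ofNat, ENNReal.rpow_ofNat]
    exact hy₀n.trans_lt hfin.lt_top
  set y := hy₀L.toLp y₀ with hy
  have hyn : ‖y‖ₑ ^ 2 ≤ lowEnergyInverse μ e t := by
    rw [← lintegral_enorm_sq_eq]
    refine le_trans (le_of_eq (lintegral_congr_ae ?_)) hy₀n
    filter_upwards [hy₀L.coeFn_toLp] with k hk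
    rw [hk]
  have hsplit : ∀ i, inner ℂ b (g i) = inner ℂ b (highEnergyPart he t (g i)) + inner ℂ y (u i) := by
    intro i
    simp only [L2.inner_def]
    rw [← integral_add (L2.integrable_inner _ _) (L2.integrable_inner _ _)]
    refine integral_congr_ae ?_
    filter_upwards [hpos, hgu i, hy₀L.coeFn_toLp, coeFn_highEnergyPart he t (g i)]
      with k hk h1 h2 h3
    rw [h1, h2, h3]
    have hs : (√(e k) : ℂ) ≠ 0 := by
      rw [Ne, Complex.ofReal_eq_zero]; exact (Real.sqrt_pos.2 hk).ne'
    by_cases hkt : e k < t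
    · rw [hy₀, Set.indicator_of_mem (show k ∈ {k | e k < t} from hkt),
        Set.indicator_of_notMem (show k ∉ {k | t ≤ e k} from not_le.2 hkt)]
      simp only [RCLike.inner_apply, map_mul, map_inv₀,
        Complex.conj_ofReal]
      field_simp
      ring
    · rw [hy₀, Set.indicator_of_notMem (show k ∉ {k | e k < t} from hkt),
        Set.indicator_of_mem (show k ∈ {k | t ≤ e k} from not_lt.1 hkt)]
      simp
  calc ∑ i, ‖inner ℂ b (g i)‖ₑ ^ 2
      ≤ ∑ i, (2 * ‖inner ℂ b (highEnergyPart he t (g i))‖ₑ ^ 2 + 2 * ‖inner ℂ y (u i)‖ₑ ^ 2) := by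
        refine Finset.sum_le_sum fun i _ => ?_
        rw [hsplit i]
        exact enorm_add_sq_le _ _
    _ = 2 * ∑ i, ‖inner ℂ b (highEnergyPart he t (g i))‖ₑ ^ 2 + 2 * ∑ i, ‖inner ℂ y (u i)‖ₑ ^ 2 := by
        rw [Finset.sum_add_distrib, Finset.mul_sum, Finset.mul_sum]
    _ ≤ _ := by
        gcongr
        exact (sum_enorm_sq_inner_le hu y).trans hyn

theorem enorm_highEnergyPart_sq {e : X → ℝ} (he : Measurable e) (t : ℝ) (g : Lp ℂ 2 μ) :
    ‖highEnergyPart he t g‖ₑ ^ 2 = ∫⁻ k in {k | t ≤ e k}, ‖g k‖ₑ ^ 2 ∂μ := by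
  rw [← lintegral_enorm_sq_eq, ← lintegral_indicator (measurableSet_le measurable_const he)]
  refine lintegral_congr_ae ?_
  filter_upwards [coeFn_highEnergyPart he t g] with k hk
  rw [hk]
  by_cases h : k ∈ {k | t ≤ e k}
  · rw [Set.indicator_of_mem h, Set.indicator_of_mem h]
  · rw [Set.indicator_of_notMem h, Set.indicator_of_notMem h]
    simp

theorem measurable_enorm_highEnergyPart_sq {e : X → ℝ} (he : Measurable e) (g : Lp ℂ 2 μ) :
    Measurable fun t => ‖highEnergyPart he t g‖ₑ ^ 2 := by
  simp_rw [enorm_highEnergyPart_sq]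
  refine Antitone.measurable fun s t hst => ?_
  exact lintegral_mono_set fun k (hk : t ≤ e k) => hst.trans hk

/-- Layer cake: the set of t > 0 with t ≤ e(k) has length e(k), so Tonelli gives the integral of e
|g|². -/
theorem lintegral_highEnergyPart_eq [SFinite μ] {e : X → ℝ} (he : Measurable e)
    (hpos : ∀ᵐ k ∂μ, 0 < e k) {g u : Lp ℂ 2 μ}
    (hgu : u =ᵐ[μ] fun k => (√(e k) : ℂ) * g k) :
    ∫⁻ t in Set.Ioi (0 : ℝ), ‖highEnergyPart he t g‖ₑ ^ 2 = ‖u‖ₑ ^ 2 := by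
  have hgm : AEMeasurable (fun k => ‖g k‖ₑ ^ 2) μ :=
    (Lp.aestronglyMeasurable g).enorm.pow_const 2
  have h1 : ∀ t, ‖highEnergyPart he t g‖ₑ ^ 2 =
      ∫⁻ k, Set.indicator {p : ℝ × X | p.1 ≤ e p.2} (fun p => ‖g p.2‖ₑ ^ 2) (t, k) ∂μ := by
    intro t
    rw [enorm_highEnergyPart_sq, ← lintegral_indicator (measurableSet_le measurable_const he)]
    rfl
  simp_rw [h1]
  rw [lintegral_lintegral_swap]
  · rw [← lintegral_enorm_sq_eq]
    refine lintegral_congr_ae ?_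
    filter_upwards [hpos, hgu] with k hk hk2
    have h2 : ∀ t, Set.indicator {p : ℝ × X | p.1 ≤ e p.2} (fun p => ‖g p.2‖ₑ ^ 2) (t, k) =
        Set.indicator (Set.Iic (e k)) (fun _ => ‖g k‖ₑ ^ 2) t := fun t => rfl
    simp_rw [h2]
    rw [lintegral_indicator_const measurableSet_Iic, Measure.restrict_apply measurableSet_Iic,
      Set.Iic_inter_Ioi, Real.volume_Ioc, sub_zero, hk2, enorm_mul, mul_pow, mul_comm,
      ← ofReal_norm (√(e k) : ℂ), Complex.norm_real, Real.norm_eq_abs,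
      abs_of_nonneg (Real.sqrt_nonneg _), ← ENNReal.ofReal_pow (Real.sqrt_nonneg _),
      Real.sq_sqrt hk.le]
  · refine AEMeasurable.indicator ?_ (measurableSet_le measurable_fst (he.comp measurable_snd))
    exact hgm.comp_snd

/-- Integrate `density_le` over 0 < t < v(x), bounding the low-energy term by its value at t = v(x),
then extend the high-energy integral to all t > 0. Summing over x, Parseval and the layer cake
formula leave ‖u_i‖² = 1 for each i. -/
theorem tsum_mul_density_le [SFinite μ] {e : X → ℝ} (he : Measurable e)
    (hpos : ∀ᵐ k ∂μ, 0 < e k) (b : HilbertBasis ι ℂ (Lp ℂ 2 μ))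
    (hb : ∀ x, ∀ᵐ k ∂μ, ‖b x k‖ ≤ 1) {g u : κ → Lp ℂ 2 μ} (hu : Orthonormal ℂ u)
    (hgu : ∀ i, u i =ᵐ[μ] fun k => (√(e k) : ℂ) * g i k) (v : ι → ℝ≥0) :
    ∑' x, (v x : ℝ≥0∞) * ∑ i, ‖inner ℂ (b x) (g i)‖ₑ ^ 2 ≤
      2 * Fintype.card κ + 2 * ∑' x, v x * lowEnergyInverse μ e (v x) := by
  have hx : ∀ x, (v x : ℝ≥0∞) * ∑ i, ‖inner ℂ (b x) (g i)‖ₑ ^ 2 ≤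
      2 * (∫⁻ t in Set.Ioi (0 : ℝ), ∑ i, ‖inner ℂ (b x) (highEnergyPart he t (g i))‖ₑ ^ 2) +
        2 * (v x * lowEnergyInverse μ e (v x)) := by
    intro x
    have hvol : volume (Set.Ioo (0 : ℝ) (v x)) = v x := by simp
    calc (v x : ℝ≥0∞) * ∑ i, ‖inner ℂ (b x) (g i)‖ₑ ^ 2
        = ∫⁻ t in Set.Ioo (0 : ℝ) (v x), ∑ i, ‖inner ℂ (b x) (g i)‖ₑ ^ 2 := by
          rw [setLIntegral_const, hvol, mul_comm]
      _ ≤ ∫⁻ t in Set.Ioo (0 : ℝ) (v x),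
            (2 * ∑ i, ‖inner ℂ (b x) (highEnergyPart he t (g i))‖ₑ ^ 2 +
              2 * lowEnergyInverse μ e (v x)) := by
          refine setLIntegral_mono' measurableSet_Ioo fun t ht => ?_
          refine (density_le he hpos (hb x) hu hgu t).trans ?_
          gcongr
          exact lintegral_mono_set fun k (hk : e k < t) => hk.trans ht.2
      _ = 2 * (∫⁻ t in Set.Ioo (0 : ℝ) (v x),
            ∑ i, ‖inner ℂ (b x) (highEnergyPart he t (g i))‖ₑ ^ 2) +
              2 * (v x * lowEnergyInverse μ e (v x)) := by
          rw [lintegral_add_right _ measurable_const, setLIntegral_const, hvol,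
            lintegral_const_mul' _ _ (by norm_num)]
          ring
      _ ≤ _ := by
          gcongr
          exact Set.Ioo_subset_Ioi_self
  refine (ENNReal.tsum_le_tsum hx).trans ?_
  rw [ENNReal.tsum_add, ENNReal.tsum_mul_left, ENNReal.tsum_mul_left]
  gcongr
  refine (tsum_lintegral_le _ _).trans ?_
  have h1 : ∀ t, ∑' x, ∑ i, ‖inner ℂ (b x) (highEnergyPart he t (g i))‖ₑ ^ 2 =
      ∑ i, ‖highEnergyPart he t (g i)‖ₑ ^ 2 := fun t => by
    rw [Summable.tsum_finsetSum fun i _ => ENNReal.summable]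
    simp_rw [tsum_enorm_sq_inner]
  simp_rw [h1]
  rw [lintegral_finsetSum _ fun i _ => measurable_enorm_highEnergyPart_sq he (g i)]
  simp_rw [lintegral_highEnergyPart_eq he hpos (hgu _)]
  simp [enorm_sq_eq_ofReal, hu.norm_eq_one]

end RuminFrank

/-! ### Quadratic forms on the lattice, the eigenvalue bound and the semiclassical comparison. -/

section Hamiltonian

variable {d : ℕ}

theorem coeFn_mulTorus (e : C(DualTorus d, ℝ)) (f : L2Torus d) :
    mulTorus e f =ᵐ[haarTorus d] fun k => (e k : ℂ) * f k := by
  have h1 := (ContinuousLinearMap.mul ℂ ℂ).coeFn_holder (r := 2)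
    (ContinuousMap.toLp (E := ℂ) ∞ (haarTorus d) ℂ
      ⟨fun k => (e k : ℂ), Complex.continuous_ofReal.comp e.continuous⟩) f
  have h2 := ContinuousMap.coeFn_toLp (p := ∞) (𝕜 := ℂ) (haarTorus d)
    (⟨fun k => (e k : ℂ), Complex.continuous_ofReal.comp e.continuous⟩ : C(DualTorus d, ℂ))
  filter_upwards [h1, h2] with k hk1 hk2
  refine hk1.trans ?_
  rw [hk2]
  rfl

theorem inner_mulTorus_left (e : C(DualTorus d, ℝ)) (f g : L2Torus d) :
    inner ℂ (mulTorus e f) g = inner ℂ f (mulTorus e g) := by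
  simp only [L2.inner_def]
  refine integral_congr_ae ?_
  filter_upwards [coeFn_mulTorus e f, coeFn_mulTorus e g] with k h1 h2
  rw [h1, h2]
  simp only [RCLike.inner_apply, map_mul, Complex.conj_ofReal]
  ring

theorem hopping_apply (e : C(DualTorus d, ℝ)) (ψ : ell2 d) :
    hopping e ψ = fourierF d (mulTorus e ((fourierF d).symm ψ)) := rfl

theorem inner_hopping_left (e : C(DualTorus d, ℝ)) (φ ψ : ell2 d) :
    inner ℂ (hopping e φ) ψ = inner ℂ φ (hopping e ψ) := by
  obtain ⟨f, rfl⟩ := (fourierF d).surjective φ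
  obtain ⟨g, rfl⟩ := (fourierF d).surjective ψ
  simp only [hopping_apply, LinearIsometryEquiv.symm_apply_apply, LinearIsometryEquiv.inner_map_map]
  exact inner_mulTorus_left e f g

variable {V : (Fin d → ℤ) → ℝ≥0} (hV : Memℓp (fun x => (V x : ℝ)) ∞)

theorem potential_apply (ψ : ell2 d) (x : Fin d → ℤ) :
    potential V hV ψ x = ((V x : ℝ) : ℂ) * ψ x := rfl

theorem inner_potential_left (φ ψ : ell2 d) :
    inner ℂ (potential V hV φ) ψ = inner ℂ φ (potential V hV ψ) := by
  rw [lp.inner_eq_tsum, lp.inner_eq_tsum]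
  refine tsum_congr fun x => ?_
  simp only [potential_apply, RCLike.inner_apply, map_mul, Complex.conj_ofReal]
  ring

theorem ofReal_re_inner_potential (ψ : ell2 d) :
    ENNReal.ofReal (inner ℂ ψ (potential V hV ψ)).re = ∑' x, (V x : ℝ≥0∞) * ‖ψ x‖ₑ ^ 2 := by
  have h : HasSum (fun x => (V x : ℝ) * ‖ψ x‖ ^ 2) (inner ℂ ψ (potential V hV ψ)).re := by
    convert Complex.hasSum_re (lp.hasSum_inner ψ (potential V hV ψ)) using 2 with x
    rw [potential_apply, RCLike.inner_apply, mul_assoc, Complex.mul_conj', ← Complex.ofReal_pow,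
      ← Complex.ofReal_mul, Complex.ofReal_re]
  rw [← h.tsum_eq, ENNReal.ofReal_tsum_of_nonneg (fun x => by positivity) h.summable]
  refine tsum_congr fun x => ?_
  rw [ENNReal.ofReal_mul (V x).coe_nonneg, ENNReal.ofReal_coe_nnreal, enorm_sq_eq_ofReal]

theorem isSelfAdjoint_hamiltonian (e : C(DualTorus d, ℝ)) : IsSelfAdjoint (hamiltonian e V hV) := by
  rw [ContinuousLinearMap.isSelfAdjoint_iff_isSymmetric]
  intro φ ψ
  change inner ℂ (hamiltonian e V hV φ) ψ = inner ℂ φ (hamiltonian e V hV ψ)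
  rw [hamiltonian, sub_apply, sub_apply, inner_sub_left, inner_sub_right, inner_hopping_left,
    inner_potential_left]

/-- The continuous function `√e` on the torus. -/
def sqrtSymbol (e : C(DualTorus d, ℝ)) : C(DualTorus d, ℝ) :=
  ⟨fun k => √(e k), Real.continuous_sqrt.comp e.continuous⟩

/-- The operator `√e F*` from `ℓ²(ℤ^d)` to `L²(Γ*)`, a square root of the form of `h(e)`. -/
def sqrtHopping (e : C(DualTorus d, ℝ)) : ell2 d →ₗ[ℂ] L2Torus d :=
  (mulTorus (sqrtSymbol e)).toLinearMap ∘ₗ (fourierF d).symm.toLinearEquiv.toLinearMap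

theorem coeFn_sqrtHopping (e : C(DualTorus d, ℝ)) (ψ : ell2 d) :
    sqrtHopping e ψ =ᵐ[haarTorus d] fun k => (√(e k) : ℂ) * (fourierF d).symm ψ k :=
  coeFn_mulTorus (sqrtSymbol e) ((fourierF d).symm ψ)

theorem inner_hopping_self {e : C(DualTorus d, ℝ)} (he : ∀ k, 0 ≤ e k) (ψ : ell2 d) :
    (inner ℂ ψ (hopping e ψ)).re = ‖sqrtHopping e ψ‖ ^ 2 := by
  obtain ⟨f, rfl⟩ := (fourierF d).surjective ψ
  have h : mulTorus (sqrtSymbol e) (mulTorus (sqrtSymbol e) f) = mulTorus e f := by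
    refine Lp.ext ?_
    filter_upwards [coeFn_mulTorus (sqrtSymbol e) (mulTorus (sqrtSymbol e) f),
      coeFn_mulTorus (sqrtSymbol e) f, coeFn_mulTorus e f] with k h1 h2 h3
    rw [h1, h2, h3, ← mul_assoc, ← Complex.ofReal_mul]
    congr 2
    exact Real.mul_self_sqrt (he k)
  rw [hopping_apply, LinearIsometryEquiv.symm_apply_apply, LinearIsometryEquiv.inner_map_map,
    ← h, ← inner_mulTorus_left, ← inner_self_eq_norm_sq (𝕜 := ℂ)]
  simp [sqrtHopping]

theorem enorm_sqrtHopping_sq_le {e : C(DualTorus d, ℝ)} (he : ∀ k, 0 ≤ e k) {ψ : ell2 d}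
    (hψ : (inner ℂ ψ (hamiltonian e V hV ψ)).re ≤ 0) :
    ‖sqrtHopping e ψ‖ₑ ^ 2 ≤ ∑' x, (V x : ℝ≥0∞) * ‖ψ x‖ₑ ^ 2 := by
  rw [← ofReal_re_inner_potential hV, enorm_sq_eq_ofReal, ← inner_hopping_self he]
  refine ENNReal.ofReal_le_ofReal ?_
  rw [hamiltonian, sub_apply, inner_sub_right, Complex.sub_re] at hψ
  linarith

theorem sqrtHopping_injective {e : C(DualTorus d, ℝ)} (hpos : ∀ᵐ k ∂haarTorus d, 0 < e k) :
    Function.Injective (sqrtHopping e) := by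
  rw [injective_iff_map_eq_zero]
  intro ψ hψ
  have h0 : (fourierF d).symm ψ = 0 := by
    refine Lp.ext ?_
    filter_upwards [coeFn_sqrtHopping e ψ, Lp.coeFn_zero ℂ 2 (haarTorus d), hpos] with k h1 h2 h3
    rw [hψ, h2] at h1
    rw [h2]
    have h4 := mul_eq_zero.1 h1.symm
    refine h4.resolve_left ?_
    rw [Complex.ofReal_eq_zero]
    exact (Real.sqrt_pos.2 h3).ne'
  simpa using h0

theorem norm_expBasis_le_one (x : Fin d → ℤ) : ∀ᵐ k ∂haarTorus d, ‖expBasis d x k‖ ≤ 1 := by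
  have h : expBasis d x = expVec x := congrFun (HilbertBasis.coe_mk _ _) x
  rw [h]
  filter_upwards [ContinuousMap.coeFn_toLp (p := 2) (𝕜 := ℂ) (haarTorus d)
    (UnitAddTorus.mFourier (-x))] with k hk
  rw [expVec, hk]
  exact (ContinuousMap.norm_coe_le_norm _ k).trans UnitAddTorus.mFourier_norm.le

/-- The Cwikel–Lieb–Rozenblum bound in terms of the low-energy part of the inverse of `e`. -/
theorem finrank_le_tsum_lowEnergyInverse {e : C(DualTorus d, ℝ)}
    (hpos : ∀ᵐ k ∂haarTorus d, 0 < e k) (v : (Fin d → ℤ) → ℝ≥0) (W : Submodule ℂ (ell2 d))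
    [FiniteDimensional ℂ W]
    (hW : ∀ ψ ∈ W, ‖sqrtHopping e ψ‖ₑ ^ 2 ≤ ∑' x, (v x : ℝ≥0∞) * ‖ψ x‖ₑ ^ 2) :
    (Module.finrank ℂ W : ℝ≥0∞) ≤
      ∑' x, ((4 * v x : ℝ≥0) : ℝ≥0∞) * lowEnergyInverse (haarTorus d) e ((4 * v x : ℝ≥0) : ℝ) := by
  -- An orthonormal basis of this image pulls back to vectors of W orthonormal for the form of h(e).
  set R := W.map (sqrtHopping e) with hR
  have hdim : Module.finrank ℂ R = Module.finrank ℂ W :=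
    (Submodule.equivMapOfInjective _ (sqrtHopping_injective hpos) W).finrank_eq.symm
  set w := stdOrthonormalBasis ℂ R
  choose φ hφW hφ using fun i => (Submodule.mem_map.1 (w i).2)
  have hu : Orthonormal ℂ fun i => ((w i : R) : L2Torus d) :=
    w.orthonormal.comp_linearIsometry R.subtypeₗᵢ
  have key := tsum_mul_density_le (μ := haarTorus d) e.continuous.measurable hpos (expBasis d)
    norm_expBasis_le_one (g := fun i => (fourierF d).symm (φ i)) hu
    (fun i => by
      have := coeFn_sqrtHopping e (φ i)
      rwa [hφ i] at this) (fun x => 4 * v x)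
  have hcoef : ∀ x i, inner ℂ (expBasis d x) ((fourierF d).symm (φ i)) = φ i x := fun x i => by
    rw [← HilbertBasis.repr_apply_apply]
    exact congrArg (fun ψ : ell2 d => ψ x) ((fourierF d).apply_symm_apply (φ i))
  simp only [hcoef, Fintype.card_fin, hdim] at key
  set n := Module.finrank ℂ W
  have hlow : (n : ℝ≥0∞) ≤ ∑' x, (v x : ℝ≥0∞) * ∑ i, ‖φ i x‖ₑ ^ 2 := by
    calc (n : ℝ≥0∞) = ∑ i, ‖sqrtHopping e (φ i)‖ₑ ^ 2 := by
          simp_rw [hφ, enorm_sq_eq_ofReal]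
          simp [hdim, hu.norm_eq_one, n]
      _ ≤ ∑ i, ∑' x, (v x : ℝ≥0∞) * ‖φ i x‖ₑ ^ 2 := Finset.sum_le_sum fun i _ => hW _ (hφW i)
      _ = _ := by
          rw [← Summable.tsum_finsetSum fun i _ => ENNReal.summable]
          simp_rw [Finset.mul_sum]
  -- The density estimate was applied to 4v so that its term 2n can be absorbed into 4n, leaving 2n.
  have h4 : 4 * (n : ℝ≥0∞) ≤ ∑' x, ((4 * v x : ℝ≥0) : ℝ≥0∞) * ∑ i, ‖φ i x‖ₑ ^ 2 := by
    refine (mul_le_mul_right hlow 4).trans (le_of_eq ?_)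
    rw [← ENNReal.tsum_mul_left]
    refine tsum_congr fun x => ?_
    push_cast
    ring
  have h5 := h4.trans key
  have h6 : (2 : ℝ≥0∞) * n + 2 * n ≤ 2 * n + 2 * ∑' x, ((4 * v x : ℝ≥0) : ℝ≥0∞) *
      lowEnergyInverse (haarTorus d) e ((4 * v x : ℝ≥0) : ℝ) := by
    refine le_trans (le_of_eq (by ring)) h5
  have h7 := ENNReal.le_of_add_le_add_left (by finiteness) h6
  exact (ENNReal.mul_le_mul_iff_right (by norm_num) (by norm_num)).1 h7

/-- The zero set lies in every sublevel set, whose measure is O(s^d); let s tend to 0. -/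
theorem IsAdmissible.ae_pos {e : C(DualTorus d, ℝ)} (hd : d ≠ 0) (he : IsAdmissible e) :
    ∀ᵐ k ∂haarTorus d, 0 < e k := by
  obtain ⟨C, hC⟩ := he.exists_sublevel_le
  rw [ae_iff]
  have hlim : Filter.Tendsto (fun s : ℝ≥0 => ((C * s ^ d : ℝ≥0) : ℝ≥0∞))
      (nhdsWithin 0 (Set.Ioi 0)) (nhds 0) := by
    have h : Continuous fun s : ℝ≥0 => ((C * s ^ d : ℝ≥0) : ℝ≥0∞) :=
      ENNReal.continuous_coe.comp (by fun_prop)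
    have h1 := h.tendsto 0
    simp only [ne_eq, hd, not_false_eq_true, zero_pow, mul_zero, ENNReal.coe_zero] at h1
    exact h1.mono_left nhdsWithin_le_nhds
  refine le_antisymm (ge_of_tendsto hlim ?_) zero_le
  filter_upwards [self_mem_nhdsWithin] with s hs
  have hs' : (0 : ℝ) < s := hs
  push_cast
  refine (measure_mono fun k hk => ?_).trans (hC s)
  exact (not_lt.1 hk).trans_lt (by positivity)

/-- The Cwikel–Lieb–Rozenblum bound for an admissible dispersion relation. -/
theorem IsAdmissible.exists_finrank_le {e : C(DualTorus d, ℝ)} (hd : 3 ≤ d) (he : IsAdmissible e) :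
    ∃ K : ℝ≥0, ∀ (v : (Fin d → ℤ) → ℝ≥0) (W : Submodule ℂ (ell2 d)), FiniteDimensional ℂ W →
      (∀ ψ ∈ W, ‖sqrtHopping e ψ‖ₑ ^ 2 ≤ ∑' x, (v x : ℝ≥0∞) * ‖ψ x‖ₑ ^ 2) →
        (Module.finrank ℂ W : ℝ≥0∞) ≤ K * ∑' x, (NNReal.sqrt (v x) : ℝ≥0∞) ^ d := by
  obtain ⟨C, hC⟩ := he.exists_sublevel_le
  have hpos := he.ae_pos (by lia)
  refine ⟨8 * C * 4 ^ d, fun v W hfin hW => ?_⟩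
  refine (finrank_le_tsum_lowEnergyInverse hpos v W hW).trans ?_
  rw [← ENNReal.tsum_mul_left]
  refine ENNReal.tsum_le_tsum fun x => ?_
  have h := mul_lowEnergyInverse_le e.continuous.measurable hpos hd hC (2 * NNReal.sqrt (v x))
  have h1 : (2 * NNReal.sqrt (v x)) ^ 2 = 4 * v x := by
    rw [mul_pow, NNReal.sq_sqrt]; norm_num
  rw [← NNReal.coe_pow, ← ENNReal.coe_pow, h1] at h
  refine h.trans (le_of_eq ?_)
  push_cast
  rw [← mul_assoc, mul_pow]
  norm_num
  ring

/-- Restricting to vectors vanishing on a finite set of sites costs at most one dimension per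
site. -/
theorem finrank_le_card_add_finrank_vanishing (W : Submodule ℂ (ell2 d)) [FiniteDimensional ℂ W]
    (S : Finset (Fin d → ℤ)) :
    ∃ W' ≤ W, (∀ ψ ∈ W', ∀ x ∈ S, ψ x = 0) ∧
      Module.finrank ℂ W ≤ S.card + Module.finrank ℂ W' := by
  let r : W →ₗ[ℂ] (S → ℂ) :=
    { toFun := fun ψ x => (ψ : ell2 d) x
      map_add' := fun _ _ => rfl
      map_smul' := fun _ _ => rfl }
  refine ⟨(LinearMap.ker r).map W.subtype, Submodule.map_subtype_le _ _, ?_, ?_⟩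
  · rintro _ ⟨ψ, hψ, rfl⟩ x hx
    exact congrFun (LinearMap.mem_ker.1 hψ) ⟨x, hx⟩
  · rw [← (Submodule.equivMapOfInjective _ W.injective_subtype (LinearMap.ker r)).finrank_eq,
      ← LinearMap.finrank_range_add_finrank_ker r]
    gcongr
    simpa using Submodule.finrank_le (LinearMap.range r)

theorem semiclassicalNumber_eq (e : C(DualTorus d, ℝ)) (V : (Fin d → ℤ) → ℝ≥0) :
    semiclassicalNumber e V =
      ∑' x, haarTorus d {k | e k < (NNReal.sqrt (V x) : ℝ) ^ 2} := by
  refine tsum_congr fun x => ?_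
  have h : {k : DualTorus d | e k - V x < 0} = {k | e k < (NNReal.sqrt (V x) : ℝ) ^ 2} := by
    ext k
    rw [Set.mem_ofPred_eq, Set.mem_ofPred_eq, sub_neg, ← NNReal.coe_pow, NNReal.sq_sqrt]
  rw [h, lintegral_indicator_one (measurableSet_lt e.continuous.measurable measurable_const)]

theorem tsum_sqrt_pow_ne_top (hd : d ≠ 0)
    (hV : Memℓp (fun x => (V x : ℝ)) ((d : ℝ≥0∞) / 2)) :
    ∑' x, (NNReal.sqrt (V x) : ℝ≥0∞) ^ d ≠ ∞ := by
  have hp : ((d : ℝ≥0∞) / 2).toReal = (d : ℝ) / 2 := by simp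
  have hs := hV.summable (by rw [hp]; positivity)
  rw [hp] at hs
  have h1 : (fun x => ‖(V x : ℝ)‖ ^ ((d : ℝ) / 2)) = fun x => ((NNReal.sqrt (V x) ^ d : ℝ≥0) : ℝ) := by
    funext x
    rw [Real.norm_eq_abs, NNReal.abs_eq, NNReal.coe_pow, Real.coe_sqrt,
      Real.sqrt_eq_rpow, ← Real.rpow_natCast, ← Real.rpow_mul (V x).coe_nonneg]
    congr 1
    ring
  rw [h1, NNReal.summable_coe] at hs
  have h2 := ENNReal.tsum_coe_ne_top_iff_summable.2 hs
  simpa using h2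

theorem IsAdmissible.exists_numNegEigenvalues_le {e : C(DualTorus d, ℝ)} (hd : 3 ≤ d)
    (he : IsAdmissible e) :
    ∃ C : ℝ≥0, 1 ≤ C ∧
      ∀ (V : (Fin d → ℤ) → ℝ≥0) (hV : Memℓp (fun x => (V x : ℝ)) ((d : ℝ≥0∞) / 2)),
        numNegEigenvalues e V (hV.of_exponent_ge le_top) ≤ C * semiclassicalNumber e V ∧
          C * semiclassicalNumber e V < ∞ := by
  classical
  obtain ⟨C, hC⟩ := he.exists_sublevel_le
  obtain ⟨c, s₀, hc, hs₀, hlow⟩ := he.exists_le_sublevel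
  obtain ⟨K, hK⟩ := he.exists_finrank_le hd
  have hd0 : d ≠ 0 := by lia
  -- The first term pays for the sites with V > s₀², the second for the others, and the last ensures
  -- C ≥ 1.
  refine ⟨(c * s₀ ^ d)⁻¹ + K * c⁻¹ + 1, by simp, fun V hV => ?_⟩
  rw [semiclassicalNumber_eq]
  have hsum := tsum_sqrt_pow_ne_top hd0 hV
  constructor
  · refine traceNegProj_le (isSelfAdjoint_hamiltonian _ e) _ fun W hfin hW => ?_
    have hSfin : {x | s₀ < NNReal.sqrt (V x)}.Finite := by
      refine (ENNReal.finite_const_le_of_tsum_ne_top hsum (ε := (s₀ : ℝ≥0∞) ^ d)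
        (by positivity)).subset fun x (hx : s₀ < NNReal.sqrt (V x)) => ?_
      exact pow_le_pow_left₀ zero_le (ENNReal.coe_le_coe.2 hx.le) d
    set S := hSfin.toFinset with hS
    obtain ⟨W', hW'W, hvan, hrank⟩ := finrank_le_card_add_finrank_vanishing W S
    -- Vectors of W' vanish on S, so truncating V there does not change its form on W'.
    set v : (Fin d → ℤ) → ℝ≥0 := fun x => if x ∈ S then 0 else V x with hv
    have hrank' := hK v W' (Submodule.finiteDimensional_of_le hW'W) fun ψ hψ => by
      have hle : (inner ℂ ψ (hamiltonian e V (hV.of_exponent_ge le_top) ψ)).re ≤ 0 := by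
        rcases eq_or_ne ψ 0 with rfl | hne
        · simp
        · exact (hW ψ (hW'W hψ) hne).le
      refine (enorm_sqrtHopping_sq_le _ he.nonneg hle).trans (le_of_eq (tsum_congr fun x => ?_))
      by_cases hx : x ∈ S
      · simp [hvan ψ hψ x hx]
      · simp [hv, hx]
    have hcard : (S.card : ℝ≥0∞) = ∑' x, if x ∈ S then 1 else 0 := by
      rw [tsum_eq_sum (s := S) fun x hx => by simp [hx]]
      simp
    calc (Module.finrank ℂ W : ℝ≥0∞) ≤ S.card + Module.finrank ℂ W' := by exact_mod_cast hrank
      _ ≤ ∑' x, ((if x ∈ S then 1 else 0) + K * (NNReal.sqrt (v x) : ℝ≥0∞) ^ d) := by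
          rw [ENNReal.tsum_add, ENNReal.tsum_mul_left, hcard]
          gcongr
      _ ≤ _ := by
          rw [← ENNReal.tsum_mul_left]
          refine ENNReal.tsum_le_tsum fun x => ?_
          rw [ENNReal.coe_add, ENNReal.coe_add, ENNReal.coe_mul, ENNReal.coe_one,
            ENNReal.coe_inv (by positivity), ENNReal.coe_inv hc.ne', ENNReal.coe_mul,
            ENNReal.coe_pow]
          have hc0 : (c : ℝ≥0∞) ≠ 0 := by positivity
          by_cases hx : x ∈ S
          · have hx' : s₀ < NNReal.sqrt (V x) := by simpa [hS] using hx
            have h1 : (c : ℝ≥0∞) * s₀ ^ d ≤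
                haarTorus d {k | e k < (NNReal.sqrt (V x) : ℝ) ^ 2} :=
              (hlow s₀ hs₀ le_rfl).trans (measure_mono fun k (hk : e k < (s₀ : ℝ) ^ 2) =>
                hk.trans_le (pow_le_pow_left₀ s₀.2 (NNReal.coe_le_coe.2 hx'.le) 2))
            simp only [hx, if_true, hv, NNReal.sqrt_zero, ENNReal.coe_zero, zero_pow hd0, mul_zero,
              add_zero]
            calc (1 : ℝ≥0∞) = ((c : ℝ≥0∞) * s₀ ^ d)⁻¹ * (c * s₀ ^ d) := by
                  rw [ENNReal.inv_mul_cancel (by positivity) (by finiteness)]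
              _ ≤ _ := by
                  gcongr
                  rw [add_assoc]
                  exact le_self_add
          · have hx' : NNReal.sqrt (V x) ≤ s₀ := by simpa [hS] using hx
            simp only [hx, if_false, hv, zero_add]
            rcases eq_or_ne (NNReal.sqrt (V x)) 0 with h0 | h0
            · simp [h0, hd0]
            have h1 := hlow _ (pos_iff_ne_zero.2 h0) hx'
            calc (K : ℝ≥0∞) * (NNReal.sqrt (V x) : ℝ≥0∞) ^ d
                = K * (c : ℝ≥0∞)⁻¹ * (c * (NNReal.sqrt (V x) : ℝ≥0∞) ^ d) := by
                  rw [mul_assoc, ← mul_assoc _ (c : ℝ≥0∞),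
                    ENNReal.inv_mul_cancel hc0 ENNReal.coe_ne_top, one_mul]
              _ ≤ _ := by
                  gcongr
                  rw [add_right_comm]
                  exact le_add_self
  · refine ENNReal.mul_lt_top ENNReal.coe_lt_top ?_
    refine (ENNReal.tsum_le_tsum fun x => hC (NNReal.sqrt (V x))).trans_lt ?_
    rw [ENNReal.tsum_mul_left]
    exact ENNReal.mul_lt_top ENNReal.coe_lt_top hsum.lt_top

end Hamiltonian

end LatticeSchrodinger

end

theorem theorem1p1 (d : ℕ) (hd : 3 ≤ d) (e : C(LatticeSchrodinger.DualTorus d, ℝ))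
    (he : LatticeSchrodinger.IsAdmissible e) :
    ∃ C : ℝ≥0, 1 ≤ C ∧
      ∀ (V : (Fin d → ℤ) → ℝ≥0) (hV : Memℓp (fun x => (V x : ℝ)) ((d : ℝ≥0∞) / 2)),
        LatticeSchrodinger.numNegEigenvalues e V (hV.of_exponent_ge le_top)
            ≤ C * LatticeSchrodinger.semiclassicalNumber e V ∧
          C * LatticeSchrodinger.semiclassicalNumber e V < ∞ :=
  he.exists_numNegEigenvalues_le hd
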